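/- Let $n \ge 0$, let $F_n$ be the free group on $a_1,\dots,a_n$, and let $\sigma_n \in \mathrm{Aut}(F_n)$ be the automorphism with $\sigma_n(a_i) = a_i^{-1}$ for every $i$. Let $\mathrm{Aut}(F_n) \to GL_n(\mathbb{Z})$ be the natural homomorphism given by the action on the abelianization $\mathbb{Z}^n$ of $F_n$; the $j$-th column of the image of $\phi$ consists of the exponent sums of $a_1,\dots,a_n$ in $\phi(a_j)$. If $\phi \in \mathrm{Aut}(F_n)$ satisfies $\phi^2 = 1$ and its image in $GL_n(\mathbb{Z})$ is $-I$, then $\phi$ is conjugate to $\sigma_n$ in $\mathrm{Aut}(F_n)$. -/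

import Mathlib

/-- The exponent-sum homomorphism from the free group `F_n` to its abelianization `ℤ^n`
(written multiplicatively); it sends the generator `a_i` to the `i`-th standard basis vector. -/
def freeGroupToInt (n : ℕ) : FreeGroup (Fin n) →* Multiplicative (Fin n → ℤ) :=
  FreeGroup.lift fun i => Multiplicative.ofAdd (Pi.single i 1)

/-- The matrix over `ℤ` induced by an endomorphism `f` of `F_n` on the abelianization `ℤ^n`:
its `j`-th column is the vector of exponent sums of `f a_j`. -/
def abMatrix {n : ℕ} (f : FreeGroup (Fin n) →* FreeGroup (Fin n)) : Matrix (Fin n) (Fin n) ℤ :=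
  Matrix.of fun i j => Multiplicative.toAdd (freeGroupToInt n (f (FreeGroup.of j))) i

/-- `abMatrix f` describes the action of `f` on the abelianization. -/
theorem freeGroupToInt_apply {n : ℕ} (f : FreeGroup (Fin n) →* FreeGroup (Fin n))
    (w : FreeGroup (Fin n)) :
    Multiplicative.toAdd (freeGroupToInt n (f w)) =
      (abMatrix f).mulVec (Multiplicative.toAdd (freeGroupToInt n w)) := by
  have h : (freeGroupToInt n).comp f =
      (AddMonoidHom.toMultiplicative (abMatrix f).mulVecLin.toAddMonoidHom).comp
        (freeGroupToInt n) := by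
    apply FreeGroup.ext_hom
    intro j
    apply Multiplicative.toAdd.injective
    funext i
    simp [freeGroupToInt, abMatrix]
  exact congrArg Multiplicative.toAdd (DFunLike.congr_fun h w)

theorem abMatrix_id (n : ℕ) : abMatrix (MonoidHom.id (FreeGroup (Fin n))) = 1 := by
  ext i j
  simp [abMatrix, freeGroupToInt, Pi.single_apply, Matrix.one_apply]

theorem abMatrix_comp {n : ℕ} (f g : FreeGroup (Fin n) →* FreeGroup (Fin n)) :
    abMatrix (f.comp g) = abMatrix f * abMatrix g := by
  ext i j
  exact congrFun (freeGroupToInt_apply f (g (FreeGroup.of j))) i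

/-- The natural homomorphism `Aut(F_n) → GL_n(ℤ)` given by the action on the abelianization. -/
def autToGL (n : ℕ) : MulAut (FreeGroup (Fin n)) →* Matrix.GeneralLinearGroup (Fin n) ℤ :=
  MonoidHom.toHomUnits
    { toFun := fun φ => abMatrix φ.toMonoidHom
      map_one' := abMatrix_id n
      map_mul' := fun φ ψ => abMatrix_comp φ.toMonoidHom ψ.toMonoidHom }

/-- The endomorphism of `F_n` sending `a_i` to `a_i⁻¹` for each `i`. -/
def invertGenerators (n : ℕ) : FreeGroup (Fin n) →* FreeGroup (Fin n) :=
  FreeGroup.lift fun i => (FreeGroup.of i)⁻¹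

theorem invertGenerators_comp_self (n : ℕ) :
    (invertGenerators n).comp (invertGenerators n) = MonoidHom.id _ := by
  apply FreeGroup.ext_hom
  intro i
  simp [invertGenerators]

/-- The automorphism `σ_n` of `F_n` which sends `a_i` to `a_i⁻¹` for each `i`. -/
def sigmaAut (n : ℕ) : MulAut (FreeGroup (Fin n)) :=
  MonoidHom.toMulEquiv (invertGenerators n) (invertGenerators n)
    (invertGenerators_comp_self n) (invertGenerators_comp_self n)

/-!
An involution `φ` of the free group `F` of rank `n` is conjugate to `σₙ` as soon as `F` is generated
by `n` elements that `φ` inverts, because free groups of finite rank are Hopfian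
(`FreeGroup.injective_of_surjective`): the endomorphism sending the generators to these elements
is an automorphism that conjugates `σₙ` to `φ`. Such elements are the products of the swap with
other involutions in the semidirect product `G` of `F` with the group of order two acting by `φ`,
so it suffices to generate `G` by the swap and `n` further involutions.

The group `G` acts on the product of two copies of the Cayley tree of `F`: an element `f` of `F` maps
`(x, y)` to `(f * x, φ f * y)`, and the generator of the group of order two exchanges the
coordinates. The orbit of a vertex under `F` is determined by its label `(φ y)⁻¹ * x`, and the
exchange acts on labels by the anti-automorphism `u ↦ (φ u)⁻¹`. Bounded cancellation yields a finite
set `D` of labels that is a subtree of the Cayley tree and is invariant under this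
anti-automorphism (`FreeGroup.exists_finite_invariant_subtree`). The vertices with labels in `D` span
a connected `G`-invariant square complex, with finitely many `F`-orbits of cells, whose quotient by
`F` has Euler characteristic `1 - n` (`exists_stage`). A horizontal slice of the complex is a
finite forest, and a leaf of it gives a free side of a square; therefore the squares can be
collapsed equivariantly (`Stage.exists_collapse`) until a connected graph is left whose
quotient by `F` has first Betti number `n`.

By this count, a cochain on the quotient by `F` is a coboundary up to a character of `F`. Since
`φ` acts on characters by `-1`, an invariant cochain is a coboundary, and the quotient by
`G` is a tree (`Stage.card_add_card_lt`). So `G` is generated by the stabilizers of the vertices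
of a lift of this tree (`exists_generating_stabilizers`). These have order at most two, and
stabilizers joined by a diagonal agree. Comparing the Euler characteristics of the two
quotients shows that `n + 1` involutions remain, one of which is the swap.
-/

/-! ### Subtrees of the Cayley tree of a free group -/

namespace FreeGroup

section Letters

variable {α : Type*}

theorem inv_mk_singleton (l : α × Bool) : (mk [l])⁻¹ = mk [(l.1, !l.2)] := by
  simp [inv_mk, invRev]

theorem of_eq_mk (i : α) : of i = mk [(i, true)] := rfl

theorem of_inv_eq_mk (i : α) : (of i)⁻¹ = mk [(i, false)] := rfl

variable [DecidableEq α]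

theorem toWord_mk_mul_of_notMem_startsWith {l : α × Bool} {g : FreeGroup α}
    (h : g ∉ startsWith (l.1, !l.2)) : (mk [l] * g).toWord = l :: g.toWord := by
  rw [toWord_mul, toWord_mk, IsReduced.singleton.reduce_eq]
  apply IsReduced.reduce_eq
  rcases hg : g.toWord with _ | ⟨k, t⟩
  · simp
  · have hr : IsReduced g.toWord := isReduced_toWord
    rw [hg] at hr
    simp only [List.singleton_append, isReduced_cons_cons]
    refine ⟨fun h1 => ?_, hr⟩
    by_contra h2
    apply h
    simp only [startsWith, Set.mem_ofPred_eq, hg]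
    simp only [List.getElem?_cons_zero, Option.some.injEq]
    ext
    · simp [h1]
    · cases hl : l.2 <;> cases hk : k.2 <;> simp_all

theorem norm_mk_mul_of_notMem_startsWith {l : α × Bool} {g : FreeGroup α}
    (h : g ∉ startsWith (l.1, !l.2)) : norm (mk [l] * g) = norm g + 1 := by
  simp [norm, toWord_mk_mul_of_notMem_startsWith h]

theorem norm_inv_mk_mul_of_mem_startsWith {l : α × Bool} {g : FreeGroup α}
    (h : g ∈ startsWith l) : norm ((mk [l])⁻¹ * g) + 1 = norm g := by
  rcases hg : g.toWord with _ | ⟨k, t⟩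
  · simp [startsWith, hg] at h
  · have hk : k = l := by simpa [startsWith, hg] using h
    subst hk
    have hr : IsReduced (k :: t) := hg ▸ isReduced_toWord
    have ht : IsReduced t := hr.infix (List.suffix_cons k t).isInfix
    have : (mk [k])⁻¹ * g = mk t := by
      rw [inv_mul_eq_iff_eq_mul, ← mk_toWord (x := g), hg, mul_mk]; rfl
    rw [this, norm, norm, hg, toWord_mk, ht.reduce_eq]; rfl

theorem mem_startsWith_iff_norm {l : α × Bool} {g : FreeGroup α} :
    g ∈ startsWith l ↔ norm ((mk [l])⁻¹ * g) < norm g := by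
  refine ⟨fun h => by have := norm_inv_mk_mul_of_mem_startsWith h; omega, fun h => ?_⟩
  by_contra h'
  rw [inv_mk_singleton, norm_mk_mul_of_notMem_startsWith (by simpa using h')] at h
  omega

theorem eq_of_mem_startsWith {l k : α × Bool} {g : FreeGroup α}
    (hl : g ∈ startsWith l) (hk : g ∈ startsWith k) : l = k := by
  simp only [startsWith, Set.mem_ofPred_eq] at hl hk
  exact Option.some_injective _ (hl.symm.trans hk)

theorem exists_mem_startsWith {g : FreeGroup α} (h : g ≠ 1) : ∃ l, g ∈ startsWith l := by
  rcases hg : g.toWord with _ | ⟨k, t⟩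
  · exact absurd (toWord_eq_nil_iff.1 hg) h
  · exact ⟨k, by simp [startsWith, hg]⟩

theorem one_notMem_startsWith (l : α × Bool) : (1 : FreeGroup α) ∉ startsWith l :=
  fun h => startsWith.ne_one _ h rfl

/-- There is no cancellation in `x⁻¹ * y` if `x` and `y` start differently. -/
theorem norm_inv_mul_of_startsWith {l : α × Bool} {x y : FreeGroup α}
    (hx : x ∈ startsWith l) (hy : y ∉ startsWith l) :
    norm (x⁻¹ * y) = norm x + norm y := by
  have : IsReduced (x⁻¹.toWord ++ y.toWord) := by
    rw [IsReduced, List.isChain_append]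
    refine ⟨isReduced_toWord, isReduced_toWord, ?_⟩
    intro a ha b hb hab
    rcases hg : x.toWord with _ | ⟨k, t⟩
    · simp [startsWith, hg] at hx
    have hk : k = l := by simpa [startsWith, hg] using hx
    rcases hg' : y.toWord with _ | ⟨k', t'⟩
    · simp [hg'] at hb
    have hk' : k' ≠ l := by
      intro h; apply hy; simp [startsWith, hg', h]
    simp only [toWord_inv, hg, invRev, List.map_cons, List.reverse_cons, List.getLast?_append,
      List.getLast?_singleton, Option.mem_def, hg', List.head?_cons, Option.some.injEq,
      Option.some_or] at ha hb
    subst ha hb hk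
    by_contra hne
    apply hk'
    ext
    · exact hab.symm
    · cases h1 : k.2 <;> cases h2 : k'.2 <;> simp_all
  rw [norm, toWord_mul, this.reduce_eq, List.length_append, ← norm, ← norm, norm_inv_eq]

theorem norm_mul_mk (u : FreeGroup α) (l : α × Bool) :
    norm (u * mk [l]) = norm u + 1 ∨ norm (u * mk [l]) + 1 = norm u := by
  rw [← norm_inv_eq, mul_inv_rev, ← norm_inv_eq (x := u)]
  by_cases h : u⁻¹ ∈ startsWith l
  · right; exact norm_inv_mk_mul_of_mem_startsWith h
  · left; rw [inv_mk_singleton, norm_mk_mul_of_notMem_startsWith (by simpa using h)]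

theorem inv_mem_startsWith_iff {u : FreeGroup α} {l : α × Bool} :
    u⁻¹ ∈ startsWith l ↔ norm (u * mk [l]) < norm u := by
  rw [mem_startsWith_iff_norm, ← norm_inv_eq (x := u * _), mul_inv_rev, norm_inv_eq (x := u)]

theorem eq_of_norm_mul_mk_lt {u : FreeGroup α} {l k : α × Bool}
    (hl : norm (u * mk [l]) < norm u) (hk : norm (u * mk [k]) < norm u) : l = k :=
  eq_of_mem_startsWith (inv_mem_startsWith_iff.2 hl) (inv_mem_startsWith_iff.2 hk)

theorem exists_norm_mul_mk_lt {u : FreeGroup α} (h : u ≠ 1) :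
    ∃ l, norm (u * mk [l]) < norm u := by
  obtain ⟨l, hl⟩ := exists_mem_startsWith (inv_ne_one.2 h)
  exact ⟨l, inv_mem_startsWith_iff.1 hl⟩

/-- A set of reduced words is parent-closed if it is closed under deleting the last letter, that is,
if it is empty or a subtree of the Cayley tree that contains the identity. -/
def ParentClosed (P : Set (FreeGroup α)) : Prop :=
  ∀ u l, u ∈ P → norm (u * mk [l]) < norm u → u * mk [l] ∈ P

/-- If the geodesic from `b` to `b * w * mk [l]` through `b * w` moves towards the identity in its
last step, then it does so in all steps before, whence `b * w` is an ancestor of `b`. -/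
theorem ParentClosed.mem_of_norm_lt {P : Set (FreeGroup α)} (hP : ParentClosed P)
    {b : FreeGroup α} (hb : b ∈ P) (w : FreeGroup α) :
    ∀ l, norm w < norm (w * mk [l]) → norm (b * w * mk [l]) < norm (b * w) → b * w ∈ P := by
  induction h : norm w generalizing w with
  | zero => intro l _ _; simpa [norm_eq_zero.1 h] using hb
  | succ m ih =>
    intro l hl hlt
    have hw : w ≠ 1 := by rintro rfl; simp at h
    obtain ⟨k, hk⟩ := exists_norm_mul_mk_lt hw
    have hkl : k ≠ l := by rintro rfl; omega
    have h1 : norm (b * w) < norm (b * w * mk [k]) := by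
      rcases norm_mul_mk (b * w) k with h | h
      · omega
      · exact absurd (eq_of_norm_mul_mk_lt (by omega) hlt) hkl
    have e : ∀ x : FreeGroup α, x * mk [k] * mk [(k.1, !k.2)] = x := fun x => by
      rw [← inv_mk_singleton, mul_inv_cancel_right]
    have h2 := ih (w * mk [k]) (by rcases norm_mul_mk w k with h' | h' <;> omega) (k.1, !k.2)
      (by rw [e]; omega) (by rw [← mul_assoc, e]; exact h1)
    have h3 := hP _ (k.1, !k.2) h2 (by rw [← mul_assoc, e]; exact h1)
    rwa [← mul_assoc, e] at h3

/-- The intersection of a subtree containing the identity with its translate by `b⁻¹`, where `b`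
lies in the subtree, is a subtree containing the identity. -/
theorem ParentClosed.inter_translate {P : Set (FreeGroup α)} (hP : ParentClosed P)
    {b : FreeGroup α} (hb : b ∈ P) : ParentClosed {u | u ∈ P ∧ b * u ∈ P} := by
  rintro u l ⟨hu, hbu⟩ hl
  refine ⟨hP u l hu hl, ?_⟩
  have e : ∀ x : FreeGroup α, x * mk [l] * mk [(l.1, !l.2)] = x := fun x => by
    rw [← inv_mk_singleton, mul_inv_cancel_right]
  rcases norm_mul_mk (b * u) l with h | h
  · refine hP.mem_of_norm_lt hb (u * mk [l]) (l.1, !l.2) (by rwa [e]) ?_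
    rw [← mul_assoc, e]; omega
  · rw [← mul_assoc]; exact hP _ l hbu (by omega)

theorem ParentClosed.mem_induction {P : Set (FreeGroup α)} (hP : ParentClosed P)
    {p : FreeGroup α → Prop} (one : p 1)
    (fwd : ∀ u i, u ∈ P → u * of i ∈ P → p u → p (u * of i))
    (bwd : ∀ u i, u ∈ P → u * of i ∈ P → p (u * of i) → p u) :
    ∀ u ∈ P, p u := by
  intro u
  induction h : norm u generalizing u with
  | zero => intro _; rwa [norm_eq_zero.1 h]
  | succ m ih =>
    intro hu
    obtain ⟨l, hl⟩ := exists_norm_mul_mk_lt (u := u) (by rintro rfl; simp at h)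
    have h1 := hP u l hu hl
    have h2 := ih _ (by rcases norm_mul_mk u l with h' | h' <;> omega) h1
    obtain ⟨i, _ | _⟩ := l
    · have := fwd _ i h1
      rw [← of_inv_eq_mk, inv_mul_cancel_right] at this
      exact this hu h2
    · exact bwd u i hu h1 h2

/-- The endpoint of the edge from `u` to `u * of i` that is farther from the identity. -/
def farEnd (e : FreeGroup α × α) : FreeGroup α :=
  if norm e.1 < norm (e.1 * of e.2) then e.1 * of e.2 else e.1

theorem farEnd_spec (u : FreeGroup α) (i : α) :
    (farEnd (u, i) = u * of i ∧ norm u < norm (u * of i)) ∨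
      (farEnd (u, i) = u ∧ norm (u * of i) < norm u) := by
  unfold farEnd
  dsimp only
  have h := norm_mul_mk u (i, true)
  rw [← of_eq_mk] at h
  split_ifs with hn
  · exact Or.inl ⟨rfl, hn⟩
  · exact Or.inr ⟨rfl, by omega⟩

theorem farEnd_injective : Function.Injective (farEnd (α := α)) := by
  have e1 : ∀ (u : FreeGroup α) i, u * of i * mk [(i, false)] = u := fun u i => by
    rw [← of_inv_eq_mk, mul_inv_cancel_right]
  rintro ⟨u, i⟩ ⟨u', i'⟩ heq
  rcases farEnd_spec u i with ⟨h, hn⟩ | ⟨h, hn⟩ <;>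
    rcases farEnd_spec u' i' with ⟨h', hn'⟩ | ⟨h', hn'⟩ <;> rw [h, h'] at heq
  · have : (i, false) = (i', false) := eq_of_norm_mul_mk_lt (u := u * of i)
      (by rw [e1]; exact hn) (by rw [heq, e1]; exact hn')
    simp only [Prod.mk.injEq, and_true] at this
    subst this
    simpa using heq
  · have : (i, false) = (i', true) := eq_of_norm_mul_mk_lt (u := u * of i)
      (by rw [e1]; exact hn) (by rw [heq]; exact hn')
    simp at this
  · have : (i, true) = (i', false) := eq_of_norm_mul_mk_lt (u := u)
      hn (by rw [heq, e1]; exact hn')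
    simp at this
  · have : (i, true) = (i', true) := eq_of_norm_mul_mk_lt (u := u)
      hn (by rw [heq]; exact hn')
    simp only [Prod.mk.injEq, and_true] at this
    rw [heq, this]

/-- A finite subtree of the Cayley tree containing the identity has one edge less than it has
vertices. -/
theorem ParentClosed.card_edges [Fintype α] {P : Finset (FreeGroup α)}
    (hP : ParentClosed (P : Set (FreeGroup α))) (h1 : 1 ∈ P) :
    ((P ×ˢ (Finset.univ : Finset α)).filter fun e => e.1 * of e.2 ∈ P).card + 1 = P.card := by
  rw [← Finset.card_erase_add_one h1, Nat.add_right_cancel_iff]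
  refine Finset.card_bij (fun e _ => farEnd e) ?_ (fun _ _ _ _ h => farEnd_injective h) ?_
  · rintro ⟨u, i⟩ h
    simp only [Finset.mem_filter, Finset.mem_product, Finset.mem_univ, and_true] at h
    rcases farEnd_spec u i with ⟨h', hn⟩ | ⟨h', hn⟩ <;> rw [h']
    · exact Finset.mem_erase.2 ⟨fun h0 => by simp [h0] at hn, h.2⟩
    · exact Finset.mem_erase.2 ⟨fun h0 => by simp [h0] at hn, h.1⟩
  · intro v hv
    obtain ⟨hv1, hv⟩ := Finset.mem_erase.1 hv
    obtain ⟨⟨i, _ | _⟩, hl⟩ := exists_norm_mul_mk_lt hv1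
    · have h2 : v * mk [(i, false)] * of i = v := by
        rw [← of_inv_eq_mk, inv_mul_cancel_right]
      refine ⟨(v * mk [(i, false)], i), ?_, ?_⟩
      · simp only [Finset.mem_filter, Finset.mem_product, Finset.mem_univ, and_true, h2]
        exact ⟨hP v _ hv hl, hv⟩
      · simp only [farEnd, h2]; rw [if_pos hl]
    · refine ⟨(v, i), ?_, ?_⟩
      · simp only [Finset.mem_filter, Finset.mem_product, Finset.mem_univ, and_true]
        exact ⟨hv, hP v _ hv hl⟩
      · simp only [farEnd]; rw [if_neg]; exact hl.not_gt

end Letters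

end FreeGroup

namespace FreeGroup

/-! ### Finite invariant subtrees -/

section Hull

variable {α : Type*} [DecidableEq α]

/-- A homomorphism of free groups of finite rank is Lipschitz for the word length. -/
theorem exists_norm_map_le [Finite α] (f : FreeGroup α →* FreeGroup α) :
    ∃ L, 1 ≤ L ∧ ∀ x, norm (f x) ≤ L * norm x := by
  cases nonempty_fintype α
  refine ⟨1 + ∑ i, norm (f (of i)), by omega, fun x => ?_⟩
  set L := 1 + ∑ i, norm (f (of i)) with hL
  have hi : ∀ i, norm (f (of i)) ≤ L := fun i => by
    have := Finset.single_le_sum (f := fun i => norm (f (of i))) (fun _ _ => Nat.zero_le _)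
      (Finset.mem_univ i)
    omega
  suffices h : ∀ l : List (α × Bool), norm (f (mk l)) ≤ L * l.length by
    simpa [mk_toWord, norm] using h x.toWord
  intro l
  induction l with
  | nil => simp [← one_eq_mk]
  | cons k t ih =>
    have : (mk (k :: t) : FreeGroup α) = mk [k] * mk t := by rw [mul_mk]; rfl
    rw [this, _root_.map_mul]
    refine (norm_mul_le _ _).trans ?_
    have hk : norm (f (mk [k])) ≤ L := by
      obtain ⟨i, _ | _⟩ := k
      · rw [← of_inv_eq_mk, _root_.map_inv, norm_inv_eq]; exact hi i
      · exact hi i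
    rw [List.length_cons]
    linarith

/-- If `x` lies outside and `x * s` inside the cone of words with prefix `u`, then the path from
`x` to `x * s` passes through `u`. Here `c` is the inverse of the last letter of `u`. -/
theorem norm_inv_mul_le_of_crossing {c : α × Bool} {u x s : FreeGroup α}
    (hx : u⁻¹ * x ∈ startsWith c) (hs : u⁻¹ * (x * s) ∉ startsWith c) :
    norm (x⁻¹ * u) ≤ norm s := by
  have h := norm_inv_mul_of_startsWith hx hs
  rw [show (u⁻¹ * x)⁻¹ * (u⁻¹ * (x * s)) = s by group, ← norm_inv_eq (x := u⁻¹ * x),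
    show (u⁻¹ * x)⁻¹ = x⁻¹ * u by group] at h
  omega

/-- If `f (mk l) * s` lies in the cone of words with prefix `u` and `s` is short, then the image under
`f` of some prefix of `l` is close to `u`: the images of the prefixes form a coarse path from
`1` into the cone. -/
theorem exists_prefix_near {f : FreeGroup α →* FreeGroup α} {L : ℕ}
    (hL : ∀ k, norm (f (mk [k])) ≤ L) {c : α × Bool} {u : FreeGroup α}
    (hu : u⁻¹ ∈ startsWith c) (l : List (α × Bool)) :
    ∀ s, norm s ≤ L → u⁻¹ * (f (mk l) * s) ∉ startsWith c →
      ∃ p, p <+: l ∧ norm ((f (mk p))⁻¹ * u) ≤ L := by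
  induction l using List.reverseRecOn with
  | nil =>
    intro s hs h
    refine ⟨[], List.prefix_rfl, (norm_inv_mul_le_of_crossing (s := s) (c := c) ?_ h).trans hs⟩
    simpa [← one_eq_mk] using hu
  | append_singleton l k ih =>
    intro s hs h
    by_cases hx : u⁻¹ * f (mk (l ++ [k])) ∈ startsWith c
    · exact ⟨_, List.prefix_rfl, (norm_inv_mul_le_of_crossing hx h).trans hs⟩
    · rw [← mul_mk, _root_.map_mul] at hx
      obtain ⟨p, hp, h⟩ := ih _ (hL k) hx
      exact ⟨p, hp.trans (List.prefix_append _ _), h⟩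

theorem toWord_mk_of_prefix {p : List (α × Bool)} {v : FreeGroup α} (h : p <+: v.toWord) :
    (mk p).toWord = p := by
  rw [toWord_mk]
  exact (isReduced_toWord.infix h.isInfix).reduce_eq

/-- The hull of `S` for the automorphism `φ`. The pair `(u, 1)` of vertices of the Cayley tree lies
in the median hull of the pairs `(φ v * s, v)` with `s ∈ S` if, whenever one branch is cut off at
`u` and one at `1`, some such pair avoids both branches; `a` and `b` are the letters at
which the two branches begin. -/
def hull (φ : MulAut (FreeGroup α)) (S : Set (FreeGroup α)) : Set (FreeGroup α) :=
  {u | ∀ a b : α × Bool, ∃ v ∉ startsWith b, ∃ s ∈ S, u⁻¹ * (φ v * s) ∉ startsWith a}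

variable {φ : MulAut (FreeGroup α)} {S : Set (FreeGroup α)}

theorem subset_hull : S ⊆ hull φ S := fun s hs a b =>
  ⟨1, one_notMem_startsWith b, s, hs, by simpa using one_notMem_startsWith a⟩

/-- The hull is invariant under the anti-automorphism `u ↦ (φ u)⁻¹`, which exchanges the roles of the
two coordinates. -/
theorem inv_map_mem_hull (hφ : ∀ x, φ (φ x) = x) (hS : ∀ s ∈ S, (φ s)⁻¹ ∈ S) {u : FreeGroup α}
    (hu : u ∈ hull φ S) : (φ u)⁻¹ ∈ hull φ S := by
  intro a b
  obtain ⟨v, hv, s, hs, h⟩ := hu b a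
  refine ⟨_, h, _, hS s hs, ?_⟩
  have e : ((φ u)⁻¹)⁻¹ * (φ (u⁻¹ * (φ v * s)) * (φ s)⁻¹) = v := by
    rw [_root_.map_mul, _root_.map_mul, _root_.map_inv, hφ]; group
  rw [e]; exact hv

theorem parentClosed_hull (h1 : 1 ∈ S) : ParentClosed (hull φ S) := by
  intro u l hu hl a b
  have hn := norm_mul_mk u l
  by_cases ha : a = (l.1, !l.2)
  · refine ⟨1, one_notMem_startsWith b, 1, h1, ?_⟩
    rw [_root_.map_one, mul_one, mul_one, inv_mem_startsWith_iff, ha, ← inv_mk_singleton,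
      mul_inv_cancel_right]
    omega
  · obtain ⟨v, hv, s, hs, h⟩ := hu l b
    refine ⟨v, hv, s, hs, fun h' => ha (eq_of_mem_startsWith h' ?_)⟩
    rw [mul_inv_rev, mul_assoc, inv_mk_singleton]
    exact startsWith_mk_mul _ (by simpa using h)

/-- Finiteness of the hull, a form of bounded cancellation: if `u` is long, then the elements
`v` for which `φ v * s` has the prefix `u` all start with the same letter. -/
theorem finite_hull [Finite α] (hφ : ∀ x, φ (φ x) = x) (hS : S.Finite) : (hull φ S).Finite := by
  obtain ⟨L₀, -, hL₀⟩ := exists_norm_map_le φ.toMonoidHom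
  obtain ⟨C, hC⟩ := (hS.image norm).bddAbove
  obtain ⟨L, hLL, hCL⟩ : ∃ L, L₀ ≤ L ∧ C ≤ L := ⟨max L₀ C, le_max_left _ _, le_max_right _ _⟩
  have hL : ∀ x, norm (φ x) ≤ L * norm x := fun x =>
    (hL₀ x).trans (Nat.mul_le_mul_right _ hLL)
  have hL1 : ∀ k, norm (φ.toMonoidHom (mk [k])) ≤ L := fun k => by
    refine (hL (mk [k])).trans ?_
    have : norm (mk [k] : FreeGroup α) ≤ 1 := norm_mk_le
    nlinarith
  have hSL : ∀ s ∈ S, norm s ≤ L := fun s hs => (hC ⟨s, hs, rfl⟩).trans hCL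
  have key : ∀ u ∈ hull φ S, norm u ≤ L * (L * (2 * L)) + L := by
    intro u hu
    by_cases hu1 : u = 1
    · simp [hu1]
    obtain ⟨c, hc⟩ := exists_mem_startsWith (inv_ne_one.2 hu1)
    have near : ∀ b, ∃ v ∉ startsWith b, ∃ p, p <+: v.toWord ∧ norm ((φ (mk p))⁻¹ * u) ≤ L := by
      intro b
      obtain ⟨v, hv, s, hs, h⟩ := hu c b
      refine ⟨v, hv, exists_prefix_near hL1 hc v.toWord s (hSL s hs) ?_⟩
      rw [mk_toWord]; exact h
    have bound : ∀ p : FreeGroup α, norm ((φ p)⁻¹ * u) ≤ L → norm p ≤ L * (2 * L) →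
        norm u ≤ L * (L * (2 * L)) + L := fun p hp hp' => by
      have h1 := norm_mul_le (φ p) ((φ p)⁻¹ * u)
      rw [mul_inv_cancel_left] at h1
      have h2 := hL p
      have h3 := Nat.mul_le_mul_left L hp'
      omega
    obtain ⟨v, -, p, hp, hpu⟩ := near c
    rcases eq_or_ne (mk p) 1 with hp1 | hp1
    · exact bound _ hpu (by simp [hp1])
    obtain ⟨b, hb⟩ := exists_mem_startsWith hp1
    obtain ⟨v', hv', p', hp', hpu'⟩ := near b
    have hb' : mk p' ∉ startsWith b := by
      intro h
      apply hv'
      simp only [startsWith, Set.mem_ofPred_eq, toWord_mk_of_prefix hp'] at h ⊢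
      obtain ⟨t, ht⟩ := hp'
      rw [← ht, List.getElem?_append_left (by cases p' <;> simp_all)]
      exact h
    refine bound _ hpu ?_
    have h1 := norm_inv_mul_of_startsWith hb hb'
    have h2 : norm (φ ((mk p)⁻¹ * mk p')) ≤ 2 * L := by
      have : φ ((mk p)⁻¹ * mk p') = ((φ (mk p))⁻¹ * u) * ((φ (mk p'))⁻¹ * u)⁻¹ := by
        rw [_root_.map_mul, _root_.map_inv]; group
      rw [this]
      refine (norm_mul_le _ _).trans ?_
      rw [norm_inv_eq]
      omega
    have h3 := hL (φ ((mk p)⁻¹ * mk p'))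
    rw [hφ] at h3
    have h4 := Nat.mul_le_mul_left L h2
    omega
  refine ((List.finite_length_le (α × Bool) (L * (L * (2 * L)) + L)).preimage
    (f := toWord) toWord_injective.injOn).subset ?_
  intro u hu
  exact key u hu

/-- For every involution `φ` of a free group of finite rank there is a finite set, containing the
inverses of the images of the generators, that is a subtree of the Cayley tree and is invariant
under the anti-automorphism `u ↦ (φ u)⁻¹`. -/
theorem exists_finite_invariant_subtree [Finite α] (hφ : ∀ x, φ (φ x) = x) :
    ∃ D : Finset (FreeGroup α), ParentClosed (D : Set (FreeGroup α)) ∧ 1 ∈ D ∧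
      (∀ i, (φ (of i))⁻¹ ∈ D) ∧ ∀ u ∈ D, (φ u)⁻¹ ∈ D := by
  let S : Set (FreeGroup α) := {1} ∪ (Set.range of ∪ Set.range fun i => (φ (of i))⁻¹)
  have hfin : S.Finite :=
    (Set.finite_singleton _).union ((Set.finite_range _).union (Set.finite_range _))
  have hS : ∀ s ∈ S, (φ s)⁻¹ ∈ S := by
    rintro s (rfl | ⟨i, rfl⟩ | ⟨i, rfl⟩)
    · left; simp
    · right; right; exact ⟨i, rfl⟩
    · right; left; exact ⟨i, by simp [hφ]⟩
  refine ⟨(finite_hull hφ hfin).toFinset, ?_, ?_, ?_, ?_⟩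
  · simpa using parentClosed_hull (φ := φ) (S := S) (Or.inl rfl)
  · simpa using subset_hull (φ := φ) (S := S) (Or.inl rfl)
  · intro i
    simpa using subset_hull (φ := φ) (S := S) (Or.inr (Or.inr ⟨i, rfl⟩))
  · intro u hu
    simpa using inv_map_mem_hull hφ hS (by simpa using hu)

end Hull

/-! ### Free groups of finite rank are Hopfian -/

section Hopf

variable {α : Type*} [DecidableEq α]

/-- A nontrivial element acts nontrivially in some finite permutation representation: left
multiplication by the generators is partially defined on the suffixes of its reduced word and
extends to permutations of them. -/
theorem exists_perm_ne_one {w : FreeGroup α} (hw : w ≠ 1) :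
    ∃ (P : Finset (FreeGroup α)) (ρ : FreeGroup α →* Equiv.Perm P), ρ w ≠ 1 := by
  classical
  let W : Finset (FreeGroup α) := (w.toWord.tails.map mk).toFinset
  have hW : ∀ s, s <:+ w.toWord → mk s ∈ W := fun s hs =>
    List.mem_toFinset.2 (List.mem_map.2 ⟨s, (List.mem_tails _ _).2 hs, rfl⟩)
  let e : ∀ i, {x : W // of i * x.1 ∈ W} ≃ {x : W // (of i)⁻¹ * x.1 ∈ W} := fun i =>
    { toFun := fun x => ⟨⟨of i * x.1.1, x.2⟩, by simp⟩
      invFun := fun x => ⟨⟨(of i)⁻¹ * x.1.1, x.2⟩, by simp⟩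
      left_inv := fun x => by simp
      right_inv := fun x => by simp }
  let σ : α → Equiv.Perm W := fun i => (e i).extendSubtype
  have hσ : ∀ i (x : W) (hx : of i * x.1 ∈ W), σ i x = ⟨of i * x.1, hx⟩ := fun i x hx =>
    (e i).extendSubtype_apply_of_mem x hx
  have h1 : (1 : FreeGroup α) ∈ W := hW [] (List.nil_suffix)
  have key : ∀ s (hs : s <:+ w.toWord), lift σ (mk s) ⟨1, h1⟩ = ⟨mk s, hW s hs⟩ := by
    intro s
    induction s with
    | nil => intro _; simp [← one_eq_mk]
    | cons k t ih =>
      intro hs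
      have ht : t <:+ w.toWord := (List.suffix_cons k t).trans hs
      have hk : (mk (k :: t) : FreeGroup α) = mk [k] * mk t := by rw [mul_mk]; rfl
      have hkW := hW _ hs
      simp only [hk] at hkW ⊢
      rw [_root_.map_mul, Equiv.Perm.mul_apply, ih ht]
      obtain ⟨i, _ | _⟩ := k
      · rw [← of_inv_eq_mk] at hkW
        simp only [← of_inv_eq_mk]
        rw [_root_.map_inv, lift_apply_of, Equiv.Perm.inv_eq_iff_eq, hσ i _ (by
          rw [mul_inv_cancel_left]; exact hW t ht)]
        simp
      · simp only [← of_eq_mk] at hkW ⊢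
        rw [lift_apply_of, hσ i _ hkW]
  refine ⟨W, lift σ, fun h => hw ?_⟩
  have := congrArg Subtype.val (key w.toWord List.suffix_rfl)
  simp only [mk_toWord] at this
  rw [h] at this
  exact this.symm

/-- Free groups of finite rank are Hopfian. Precomposition with a surjective endomorphism permutes
the finitely many homomorphisms to a given finite group, so its kernel lies in the kernel of
each of them. -/
theorem injective_of_surjective [Finite α] (f : FreeGroup α →* FreeGroup α)
    (hf : Function.Surjective f) : Function.Injective f := by
  refine (injective_iff_map_eq_one f).2 fun x hx => ?_
  by_contra hx1
  obtain ⟨P, ρ, hρ⟩ := exists_perm_ne_one hx1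
  have : Finite (FreeGroup α →* Equiv.Perm P) := Finite.of_equiv _ lift
  have hinj : Function.Injective fun g : FreeGroup α →* Equiv.Perm P => g.comp f :=
    fun g g' h => MonoidHom.cancel_right hf |>.1 h
  obtain ⟨g, hg⟩ := Finite.surjective_of_injective hinj ρ
  apply hρ
  rw [← hg]
  simp [hx]

end Hopf

end FreeGroup

/-! ### Groups acting on graphs whose quotient is a tree -/

section TreeOfOrbits

open MulAction Relation

variable {G V ι κ : Type*} [Group G] [MulAction G V]
  {R : ι → V → V → Prop} {cls : V → κ} {v₀ : V}

theorem Relation.EqvGen.exists_crossing {r : V → V → Prop} {p q : V} (h : EqvGen r p q)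
    {C : V → Prop} (hp : C p) (hq : ¬ C q) : ∃ x y, (r x y ∨ r y x) ∧ C x ∧ ¬ C y := by
  by_contra! hno
  suffices ∀ {p q}, EqvGen r p q → (C p ↔ C q) from hq ((this h).1 hp)
  intro p q h
  induction h with
  | rel x y h => exact ⟨hno x y (Or.inl h), hno y x (Or.inr h)⟩
  | refl x => rfl
  | symm x y _ ih => exact ih.symm
  | trans x y z _ _ h1 h2 => exact h1.trans h2

/-- A partial lift of the quotient of a `G`-graph: vertices `Y` in distinct orbits, with all the
edges labelled by `J` joining them, as many as a tree has, and vertices `X` whose stabilizers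
contain those of all vertices of `Y`. The edges with labels in `M`, along which the
stabilizers agree, allow one to omit as many vertices from `X`. -/
structure PartialLift [DecidableEq ι] (G : Type*) [Group G] [MulAction G V]
    (R : ι → V → V → Prop) (cls : V → κ) (K : Finset κ) (M : Finset ι) (v₀ : V)
    (Y X : Finset V) (J : Finset ι) : Prop where
  base_mem : v₀ ∈ Y
  cls_mem : ∀ y ∈ Y, cls y ∈ K
  injOn : Set.InjOn cls Y
  edge : ∀ i ∈ J, ∃ p ∈ Y, ∃ q ∈ Y, R i p q
  card_eq : J.card + 1 = Y.card
  base_mem' : v₀ ∈ X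
  subset : X ⊆ Y
  stab_ne_bot : ∀ x ∈ X, stabilizer G x ≠ ⊥
  stab_le : ∀ y ∈ Y, stabilizer G y ≤ ⨆ x ∈ X, stabilizer G x
  card_add_le : X.card + (J ∩ M).card ≤ {y ∈ (Y : Set V) | stabilizer G y ≠ ⊥}.ncard

variable [DecidableEq ι] {K : Finset κ} {M : Finset ι}

theorem PartialLift.singleton (hK₀ : cls v₀ ∈ K) (h₀ : stabilizer G v₀ ≠ ⊥) :
    PartialLift G R cls K M v₀ {v₀} {v₀} ∅ where
  base_mem := Finset.mem_singleton_self _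
  cls_mem := by simpa using hK₀
  injOn := by simp
  edge := by simp
  card_eq := by simp
  base_mem' := Finset.mem_singleton_self _
  subset := subset_rfl
  stab_ne_bot := by simpa using h₀
  stab_le := by simp
  card_add_le := by
    have : {y ∈ (({v₀} : Finset V) : Set V) | stabilizer G y ≠ ⊥} = {v₀} := by
      ext y; simp only [Finset.coe_singleton, Set.mem_singleton_iff, Set.mem_ofPred_eq]
      exact ⟨fun h => h.1, fun h => ⟨h, h ▸ h₀⟩⟩
    rw [this]; simp

theorem PartialLift.extend {Y X : Finset V} {J : Finset ι}
    (hL : PartialLift G R cls K M v₀ Y X J)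
    (hinv : ∀ i (g : G) p q, R i p q → R i (g • p) (g • q))
    (htr : ∀ i p q p' q', R i p q → R i p' q' → ∃ g : G, p' = g • p ∧ q' = g • q)
    (hcls : ∀ p q, cls p = cls q ↔ ∃ g : G, q = g • p)
    (hM : ∀ i ∈ M, ∀ p q, R i p q → stabilizer G p = stabilizer G q ∧ stabilizer G p ≠ ⊥)
    (hK : ∀ i p q, R i p q → cls p ∈ K ∧ cls q ∈ K)
    {v : V} (hv : EqvGen (fun p q => ∃ i, R i p q) v₀ v) (hvY : ∀ y ∈ Y, cls y ≠ cls v) :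
    ∃ Y' X' J', PartialLift G R cls K M v₀ Y' X' J' ∧ Y'.card = Y.card + 1 := by
  classical
  obtain ⟨p, q, hpq, ⟨y, hy, hyp⟩, hq⟩ := hv.exists_crossing
    (C := fun p => ∃ y ∈ Y, cls y = cls p) ⟨v₀, hL.base_mem, rfl⟩ (by push Not; exact hvY)
  obtain ⟨g, rfl⟩ := (hcls p y).1 hyp.symm
  have hq' : ∀ y ∈ Y, cls y ≠ cls (g • q) := fun y hy h =>
    hq ⟨y, hy, h.trans ((hcls _ _).2 ⟨g⁻¹, by simp⟩)⟩
  have hqY : g • q ∉ Y := fun h => hq' _ h rfl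
  obtain ⟨i, hi⟩ : ∃ i, R i (g • p) (g • q) ∨ R i (g • q) (g • p) := by
    rcases hpq with ⟨i, hi⟩ | ⟨i, hi⟩
    · exact ⟨i, Or.inl (hinv i g _ _ hi)⟩
    · exact ⟨i, Or.inr (hinv i g _ _ hi)⟩
  -- The endpoints of an edge with a label in `J` lie in orbits of elements of `Y`.
  have hiJ : i ∉ J := by
    intro h
    obtain ⟨a, ha, b, hb, hab⟩ := hL.edge i h
    rcases hi with hi | hi
    · obtain ⟨g', -, h2⟩ := htr _ _ _ _ _ hab hi
      exact hq' b hb ((hcls _ _).2 ⟨g', h2⟩)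
    · obtain ⟨g', h1, -⟩ := htr _ _ _ _ _ hab hi
      exact hq' a ha ((hcls _ _).2 ⟨g', h1⟩)
  have hXq : g • q ∉ X := fun h => hqY (hL.subset h)
  have hinj : Set.InjOn cls (insert (g • q) Y : Finset V) := by
    rw [Finset.coe_insert, Set.injOn_insert (by simpa using hqY)]
    refine ⟨hL.injOn, ?_⟩
    rintro ⟨y, hy, h⟩
    exact hq' y hy h
  have hedge : ∀ j ∈ insert i J, ∃ a ∈ insert (g • q) Y, ∃ b ∈ insert (g • q) Y, R j a b := by
    intro j hj
    rcases Finset.mem_insert.1 hj with rfl | hj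
    · rcases hi with hi | hi
      · exact ⟨_, Finset.mem_insert_of_mem hy, _, Finset.mem_insert_self _ _, hi⟩
      · exact ⟨_, Finset.mem_insert_self _ _, _, Finset.mem_insert_of_mem hy, hi⟩
    · obtain ⟨a, ha, b, hb, hab⟩ := hL.edge j hj
      exact ⟨a, Finset.mem_insert_of_mem ha, b, Finset.mem_insert_of_mem hb, hab⟩
  have hclsK : ∀ z ∈ insert (g • q) Y, cls z ∈ K := by
    intro z hz
    rcases Finset.mem_insert.1 hz with rfl | hz
    · rcases hi with hi | hi
      · exact (hK _ _ _ hi).2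
      · exact (hK _ _ _ hi).1
    · exact hL.cls_mem z hz
  have hcard : (insert i J).card + 1 = (insert (g • q) Y).card := by
    rw [Finset.card_insert_of_notMem hiJ, Finset.card_insert_of_notMem hqY, hL.card_eq]
  have hYfin : {y ∈ (Y : Set V) | stabilizer G y ≠ ⊥}.Finite :=
    Y.finite_toSet.subset fun _ h => h.1
  have hins : stabilizer G (g • q) ≠ ⊥ →
      {y ∈ ((insert (g • q) Y : Finset V) : Set V) | stabilizer G y ≠ ⊥}.ncard =
        {y ∈ (Y : Set V) | stabilizer G y ≠ ⊥}.ncard + 1 := by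
    intro h
    rw [← Set.ncard_insert_of_notMem (fun h => hqY h.1) hYfin]
    congr 1
    ext y
    simp only [Finset.coe_insert, Set.mem_insert_iff, Set.mem_ofPred_eq]
    constructor
    · rintro ⟨rfl | h1, h2⟩
      · exact Or.inl rfl
      · exact Or.inr ⟨h1, h2⟩
    · rintro (rfl | h1)
      · exact ⟨Or.inl rfl, h⟩
      · exact ⟨Or.inr h1.1, h1.2⟩
  have hmono : {y ∈ (Y : Set V) | stabilizer G y ≠ ⊥}.ncard ≤
      {y ∈ ((insert (g • q) Y : Finset V) : Set V) | stabilizer G y ≠ ⊥}.ncard := by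
    refine Set.ncard_le_ncard (fun y h => ⟨by simp [h.1], h.2⟩) ?_
    exact (insert (g • q) Y).finite_toSet.subset fun _ h => h.1
  have hold := hL.card_add_le
  by_cases hiM : i ∈ M
  · have hst : stabilizer G (g • q) = stabilizer G (g • p) ∧ stabilizer G (g • q) ≠ ⊥ := by
      rcases hi with hi | hi
      · have := hM i hiM _ _ hi
        exact ⟨this.1.symm, this.1 ▸ this.2⟩
      · exact hM i hiM _ _ hi
    refine ⟨insert (g • q) Y, X, insert i J, ⟨Finset.mem_insert_of_mem hL.base_mem, hclsK, hinj, hedge,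
      hcard, hL.base_mem', hL.subset.trans (Finset.subset_insert _ _), hL.stab_ne_bot, ?_, ?_⟩,
      Finset.card_insert_of_notMem hqY⟩
    · intro z hz
      rcases Finset.mem_insert.1 hz with rfl | hz
      · rw [hst.1]; exact hL.stab_le _ hy
      · exact hL.stab_le _ hz
    · rw [hins hst.2, Finset.insert_inter_of_mem hiM,
        Finset.card_insert_of_notMem (fun h => hiJ (Finset.mem_inter.1 h).1)]
      omega
  · by_cases hst : stabilizer G (g • q) = ⊥
    · refine ⟨insert (g • q) Y, X, insert i J, ⟨Finset.mem_insert_of_mem hL.base_mem, hclsK, hinj,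
        hedge, hcard, hL.base_mem', hL.subset.trans (Finset.subset_insert _ _), hL.stab_ne_bot,
        ?_, ?_⟩, Finset.card_insert_of_notMem hqY⟩
      · intro z hz
        rcases Finset.mem_insert.1 hz with rfl | hz
        · rw [hst]; exact bot_le
        · exact hL.stab_le _ hz
      · rw [Finset.insert_inter_of_notMem hiM]
        omega
    · refine ⟨insert (g • q) Y, insert (g • q) X, insert i J,
        ⟨Finset.mem_insert_of_mem hL.base_mem, hclsK, hinj, hedge, hcard,
        Finset.mem_insert_of_mem hL.base_mem', Finset.insert_subset_insert _ hL.subset, ?_,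
        ?_, ?_⟩, Finset.card_insert_of_notMem hqY⟩
      · intro z hz
        rcases Finset.mem_insert.1 hz with rfl | hz
        · exact hst
        · exact hL.stab_ne_bot z hz
      · intro z hz
        rcases Finset.mem_insert.1 hz with rfl | hz
        · exact le_iSup₂_of_le _ (Finset.mem_insert_self _ _) le_rfl
        · exact (hL.stab_le z hz).trans
            (biSup_mono fun _ h => Finset.mem_insert_of_mem h)
      · rw [hins hst, Finset.insert_inter_of_notMem hiM, Finset.card_insert_of_notMem hXq]
        omega

/-- If the quotient of a connected `G`-graph is a tree, then `G` is generated by the stabilizers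
of the vertices of a lift of that tree. An edge along which the stabilizers agree makes one
of them redundant. That the quotient is a tree is expressed by counting: it has at least
one vertex more than edges. -/
theorem exists_generating_stabilizers [Fintype ι]
    (hinv : ∀ i (g : G) p q, R i p q → R i (g • p) (g • q))
    (htr : ∀ i p q p' q', R i p q → R i p' q' → ∃ g : G, p' = g • p ∧ q' = g • q)
    (hcls : ∀ p q, cls p = cls q ↔ ∃ g : G, q = g • p)
    (hM : ∀ i ∈ M, ∀ p q, R i p q → stabilizer G p = stabilizer G q ∧ stabilizer G p ≠ ⊥)
    (hK : ∀ i p q, R i p q → cls p ∈ K ∧ cls q ∈ K)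
    (hK₀ : cls v₀ ∈ K) (h₀ : stabilizer G v₀ ≠ ⊥)
    (hconn : ∀ k ∈ K, ∃ v, EqvGen (fun p q => ∃ i, R i p q) v₀ v ∧ cls v = k)
    (hconn' : ∀ g : G, EqvGen (fun p q => ∃ i, R i p q) v₀ (g • v₀))
    (hcard : Fintype.card ι + 1 ≤ K.card) :
    Fintype.card ι + 1 = K.card ∧ ∃ X : Finset V, v₀ ∈ X ∧ (∀ x ∈ X, stabilizer G x ≠ ⊥) ∧
      (⨆ x ∈ X, stabilizer G x) = ⊤ ∧ X.card + M.card ≤ {k ∈ (K : Set κ) | ∃ v, cls v = k ∧ stabilizer G v ≠ ⊥}.ncard := by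
  classical
  have ext : ∀ {Y X J}, PartialLift G R cls K M v₀ Y X J → Y.card < K.card →
      ∃ Y' X' J', PartialLift G R cls K M v₀ Y' X' J' ∧ Y'.card = Y.card + 1 := by
    intro Y X J hL hlt
    obtain ⟨k, hkK, hk⟩ : ∃ k ∈ K, k ∉ Y.image cls :=
      Finset.exists_mem_notMem_of_card_lt_card (Finset.card_image_le.trans_lt hlt)
    obtain ⟨v, hv, rfl⟩ := hconn k hkK
    exact hL.extend hinv htr hcls hM hK hv fun y hy h => hk (Finset.mem_image.2 ⟨y, hy, h⟩)
  have grow : ∀ m, m < K.card →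
      ∃ Y X J, PartialLift G R cls K M v₀ Y X J ∧ Y.card = m + 1 := by
    intro m
    induction m with
    | zero => exact fun _ => ⟨_, _, _, PartialLift.singleton hK₀ h₀, rfl⟩
    | succ m ih =>
      intro hm
      obtain ⟨Y, X, J, hL, hY⟩ := ih (by omega)
      obtain ⟨Y', X', J', hL', hY'⟩ := ext hL (by omega)
      exact ⟨Y', X', J', hL', by omega⟩
  have heq : Fintype.card ι + 1 = K.card := by
    obtain ⟨Y, X, J, hL, hY⟩ := grow (K.card - 1) (by omega)
    have h1 := hL.card_eq
    have h2 := J.card_le_univ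
    omega
  obtain ⟨Y, X, J, hL, hY⟩ := grow (Fintype.card ι) (by omega)
  have hJ : J = Finset.univ := by
    rw [← Finset.card_eq_iff_eq_univ]
    have := hL.card_eq
    omega
  set H : Subgroup G := ⨆ x ∈ X, stabilizer G x with hH
  have hyy : ∀ {y y'} (g : G), y ∈ Y → y' ∈ Y → y = g • y' → y = y' ∧ g ∈ H := by
    intro y y' g hy hy' h
    have e : y' = y := hL.injOn hy' hy ((hcls _ _).2 ⟨g, h⟩)
    refine ⟨e.symm, hL.stab_le y hy ?_⟩
    rw [e] at h
    exact mem_stabilizer_iff.2 h.symm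
  have step : ∀ i p q, R i p q →
      ((∃ h ∈ H, ∃ y ∈ Y, p = h • y) ↔ (∃ h ∈ H, ∃ y ∈ Y, q = h • y)) := by
    intro i p q hpq
    obtain ⟨a, ha, b, hb, hab⟩ := hL.edge i (hJ ▸ Finset.mem_univ i)
    obtain ⟨g, rfl, rfl⟩ := htr _ _ _ _ _ hab hpq
    constructor
    · rintro ⟨h, hh, y, hy, e⟩
      obtain ⟨-, h2⟩ := hyy (h⁻¹ * g) hy ha (by rw [mul_smul, e, inv_smul_smul])
      exact ⟨g, by simpa using H.mul_mem hh h2, b, hb, rfl⟩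
    · rintro ⟨h, hh, y, hy, e⟩
      obtain ⟨-, h2⟩ := hyy (h⁻¹ * g) hy hb (by rw [mul_smul, e, inv_smul_smul])
      exact ⟨g, by simpa using H.mul_mem hh h2, a, ha, rfl⟩
  have reach : ∀ {p q}, EqvGen (fun p q => ∃ i, R i p q) p q →
      ((∃ h ∈ H, ∃ y ∈ Y, p = h • y) ↔ (∃ h ∈ H, ∃ y ∈ Y, q = h • y)) := by
    intro p q h
    induction h with
    | rel x y h => exact h.elim fun i hi => step i x y hi
    | refl x => rfl
    | symm x y _ ih => exact ih.symm
    | trans x y z _ _ h1 h2 => exact h1.trans h2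
  refine ⟨heq, X, hL.base_mem', hL.stab_ne_bot, ?_, ?_⟩
  · refine eq_top_iff.2 fun g _ => ?_
    obtain ⟨h, hh, y, hy, e⟩ := (reach (hconn' g)).1
      ⟨1, H.one_mem, v₀, hL.base_mem, (one_smul _ _).symm⟩
    obtain ⟨-, h2⟩ := hyy (h⁻¹ * g) hy hL.base_mem (by rw [mul_smul, e, inv_smul_smul])
    simpa using H.mul_mem hh h2
  · have h1 := hL.card_add_le
    rw [hJ, Finset.univ_inter] at h1
    refine h1.trans ?_
    rw [← Set.InjOn.ncard_image (f := cls) (hL.injOn.mono fun y h => h.1)]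
    exact Set.ncard_le_ncard (by
      rintro _ ⟨y, hy, rfl⟩
      exact ⟨hL.cls_mem y hy.1, y, rfl, hy.2⟩) (K.finite_toSet.subset fun _ h => h.1)

end TreeOfOrbits

/-! ### The equivariant collapse of a square complex in a product of two trees -/

section Collapse

open FreeGroup hiding map_mul map_inv map_one
open Relation

variable {n : ℕ} (φ : MulAut (FreeGroup (Fin n)))

/-- The edges with label `e = (u, i)` in the product of two copies of the Cayley tree: those from
`(x, y)` to `(x * aᵢ, y)` with `(φ y)⁻¹ * x = u`, and their mirror images. -/
def Side (e : FreeGroup (Fin n) × Fin n) (p q : FreeGroup (Fin n) × FreeGroup (Fin n)) : Prop :=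
  ((φ p.2)⁻¹ * p.1 = e.1 ∧ q = (p.1 * of e.2, p.2)) ∨
    ((φ p.1)⁻¹ * p.2 = e.1 ∧ q = (p.1, p.2 * of e.2))

/-- The diagonals of the squares with label `e = (u, i)`, from `(x, y)` to `(x * aᵢ, y * aᵢ)`
with `(φ y)⁻¹ * x = u`. -/
def Diagonal (e : FreeGroup (Fin n) × Fin n)
    (p q : FreeGroup (Fin n) × FreeGroup (Fin n)) : Prop :=
  (φ p.2)⁻¹ * p.1 = e.1 ∧ q = (p.1 * of e.2, p.2 * of e.2)

/-- The graph with the sides labelled by `E` and the diagonals labelled by `M`. -/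
def Link (E M : Finset (FreeGroup (Fin n) × Fin n))
    (p q : FreeGroup (Fin n) × FreeGroup (Fin n)) : Prop :=
  (∃ e ∈ E, Side φ e p q) ∨ ∃ e ∈ M, Diagonal φ e p q

/-- A stage of the equivariant collapse of the square complex in the product of two trees whose
vertices are the pairs `(x, y)` with `(φ y)⁻¹ * x ∈ D`. The finite sets `E`, `M` and `Sq`
label the sides, the diagonals and the squares that are present; the square `(u, i, j)` has
the corners `(x, y)`, `(x * aᵢ, y)`, `(x, y * aⱼ)` and `(x * aᵢ, y * aⱼ)` where
`(φ y)⁻¹ * x = u`. The last field says that the Euler characteristic is that of a rose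
with `n` petals. -/
structure Stage (D : Finset (FreeGroup (Fin n))) (E M : Finset (FreeGroup (Fin n) × Fin n))
    (Sq : Finset (FreeGroup (Fin n) × Fin n × Fin n)) : Prop where
  side_mem : ∀ u i, (u, i) ∈ E → u ∈ D ∧ u * of i ∈ D
  diag_mem : ∀ u i, (u, i) ∈ M → (φ u)⁻¹ = u ∧ u ∈ D ∧ (φ (of i))⁻¹ * u * of i ∈ D
  diag_notMem : ∀ u i, (u, i) ∈ M → (u, i, i) ∉ Sq
  symm : ∀ u i j, (u, i, j) ∈ Sq → ((φ u)⁻¹, j, i) ∈ Sq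
  side_of_square : ∀ u i j, (u, i, j) ∈ Sq → (u, i) ∈ E ∧ ((φ (of j))⁻¹ * u, i) ∈ E
  conn : ∀ x y, (φ y)⁻¹ * x ∈ D → EqvGen (Link φ E M) (1, 1) (x, y)
  card_eq : 2 * E.card + M.card + 1 = D.card + n + Sq.card

variable {φ} {D : Finset (FreeGroup (Fin n))} {E M : Finset (FreeGroup (Fin n) × Fin n)}
  {Sq : Finset (FreeGroup (Fin n) × Fin n × Fin n)}

theorem inv_map_inv_map (hφ : ∀ x, φ (φ x) = x) (x : FreeGroup (Fin n)) :
    (φ (φ x)⁻¹)⁻¹ = x := by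
  rw [map_inv, hφ, inv_inv]

variable (φ) in
theorem inv_map_mul (x y : FreeGroup (Fin n)) : (φ (x * y))⁻¹ = (φ y)⁻¹ * (φ x)⁻¹ := by
  rw [map_mul, mul_inv_rev]

theorem inv_map_inv_map_mul (hφ : ∀ x, φ (φ x) = x) (x y : FreeGroup (Fin n)) :
    (φ ((φ y)⁻¹ * x))⁻¹ = (φ x)⁻¹ * y := by
  rw [map_mul, map_inv, hφ, mul_inv_rev, inv_inv]

theorem Link.swap (hφ : ∀ x, φ (φ x) = x) (hM : ∀ u i, (u, i) ∈ M → (φ u)⁻¹ = u)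
    {p q : FreeGroup (Fin n) × FreeGroup (Fin n)} (h : Link φ E M p q) :
    Link φ E M p.swap q.swap := by
  rcases h with ⟨e, he, h | h⟩ | ⟨e, he, h⟩
  · exact Or.inl ⟨e, he, Or.inr ⟨h.1, by rw [h.2]; rfl⟩⟩
  · exact Or.inl ⟨e, he, Or.inl ⟨h.1, by rw [h.2]; rfl⟩⟩
  · refine Or.inr ⟨e, he, ?_, by rw [h.2]; rfl⟩
    have := hM e.1 e.2 he
    rw [← h.1, inv_map_inv_map_mul hφ] at this
    exact this.trans h.1

theorem Relation.EqvGen.map_of_imp {α β : Type*} {r : α → α → Prop} {s : β → β → Prop} (f : α → β)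
    (h : ∀ p q, r p q → EqvGen s (f p) (f q)) {p q : α} (hpq : EqvGen r p q) :
    EqvGen s (f p) (f q) := by
  induction hpq with
  | rel x y hxy => exact h x y hxy
  | refl x => exact .refl _
  | symm x y _ ih => exact ih.symm
  | trans x y z _ _ h1 h2 => exact h1.trans _ _ _ h2

/-- If all sides with a vertical representative labelled `e₀` can be replaced by other paths, then
all of the graph can. -/
theorem eqvGen_link_of_vertical (hφ : ∀ x, φ (φ x) = x) {E' M' : Finset (FreeGroup (Fin n) × Fin n)}
    (hM' : ∀ u i, (u, i) ∈ M' → (φ u)⁻¹ = u) {e₀ : FreeGroup (Fin n) × Fin n}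
    (hE : ∀ e ∈ E, e ≠ e₀ → e ∈ E') (hM : M ⊆ M')
    (hv : ∀ x y, (φ x)⁻¹ * y = e₀.1 → EqvGen (Link φ E' M') (x, y) (x, y * of e₀.2))
    {p q : FreeGroup (Fin n) × FreeGroup (Fin n)} (h : EqvGen (Link φ E M) p q) :
    EqvGen (Link φ E' M') p q := by
  refine EqvGen.map_of_imp id ?_ h
  rintro ⟨x, y⟩ q (⟨e, he, h⟩ | ⟨e, he, h⟩)
  · by_cases hee : e = e₀
    · subst hee
      rcases h with ⟨h1, rfl⟩ | ⟨h1, rfl⟩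
      · exact EqvGen.map_of_imp Prod.swap (fun _ _ h => .rel _ _ (h.swap hφ hM')) (hv y x h1)
      · exact hv x y h1
    · exact .rel _ _ (Or.inl ⟨e, hE e he hee, h⟩)
  · exact .rel _ _ (Or.inr ⟨e, hM he, h⟩)

/-- A square can be collapsed together with its mirror image. Among the horizontal sides of squares
choose one whose far end `w` is farthest from the identity; then the vertical side at `w` lies in
no other square. If the square is its own mirror image, then the free vertical side and its mirror
image meet at a corner on the diagonal, and the diagonal is added instead. -/
theorem Stage.exists_collapse (hφ : ∀ x, φ (φ x) = x) (hS : Stage φ D E M Sq)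
    (hne : Sq.Nonempty) : ∃ E' M' Sq', Stage φ D E' M' Sq' ∧ Sq'.card < Sq.card := by
  obtain ⟨⟨u, i, j⟩, hq, hmax⟩ := Sq.exists_max_image (fun q => norm (farEnd (q.1, q.2.1))) hne
  obtain ⟨w, hw⟩ : ∃ w, w = farEnd (u, i) := ⟨_, rfl⟩
  simp only [← hw] at hmax
  have hnorm := farEnd_spec u i
  rw [← hw] at hnorm
  -- Each square at a vertical side labelled `(w, j)` has the horizontal side `(u, i)`.
  have free : ∀ u' i' j', (u', i', j') ∈ Sq → w = u' ∨ w = u' * of i' → u' = u ∧ i' = i := by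
    intro u' i' j' h h'
    have h1 := hmax _ h
    have h2 : w = farEnd (u', i') := by
      dsimp only at h1
      rcases farEnd_spec u' i' with ⟨e, hn⟩ | ⟨e, hn⟩ <;> rw [e] at h1 ⊢ <;>
        rcases h' with h' | h' <;> try exact h'
      · rw [h'] at h1; omega
      · rw [h'] at h1; omega
    have := farEnd_injective (hw.symm.trans h2)
    simp only [Prod.mk.injEq] at this
    exact ⟨this.1.symm, this.2.symm⟩
  have psi_mul := inv_map_mul φ
  have psi_mul' := inv_map_inv_map_mul hφ
  have psi_psi := inv_map_inv_map hφ
  have hqs := hS.symm _ _ _ hq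
  set e₀ : FreeGroup (Fin n) × Fin n := ((φ w)⁻¹, j) with he₀
  have free1 : ∀ u' i' j', (u', i', j') ∈ Sq → (u', i') = e₀ ∨ ((φ (of j'))⁻¹ * u', i') = e₀ →
      (u', i', j') = ((φ u)⁻¹, j, i) := by
    intro u' i' j' h h'
    have h1 := hS.symm _ _ _ h
    obtain ⟨h2, h3⟩ : (w = (φ u')⁻¹ ∨ w = (φ u')⁻¹ * of j') ∧ i' = j := by
      simp only [he₀, Prod.mk.injEq] at h'
      rcases h' with ⟨h', h''⟩ | ⟨h', h''⟩
      · exact ⟨Or.inl (by rw [h', psi_psi]), h''⟩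
      · exact ⟨Or.inr (by rw [← psi_mul', h', psi_psi]), h''⟩
    obtain ⟨h4, h5⟩ := free _ _ _ h1 h2
    rw [← h4, psi_psi, h3, h5]
  have he₀E : e₀ ∈ E := by
    obtain ⟨h1, h2⟩ := hS.side_of_square _ _ _ hqs
    rcases hnorm with ⟨h, -⟩ | ⟨h, -⟩
    · rw [he₀, h, psi_mul]; exact h2
    · rw [he₀, h]; exact h1
  set Sq' := (Sq.erase (u, i, j)).erase ((φ u)⁻¹, j, i) with hSq'
  have mem' : ∀ {q}, q ∈ Sq' ↔ q ≠ ((φ u)⁻¹, j, i) ∧ q ≠ (u, i, j) ∧ q ∈ Sq := by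
    intro q; simp [hSq', Finset.mem_erase]
  have symm' : ∀ u' i' j', (u', i', j') ∈ Sq' → ((φ u')⁻¹, j', i') ∈ Sq' := by
    intro u' i' j' h
    obtain ⟨h1, h2, h3⟩ := mem'.1 h
    refine mem'.2 ⟨?_, ?_, hS.symm _ _ _ h3⟩
    · intro h; apply h2
      simp only [Prod.mk.injEq] at h ⊢
      refine ⟨?_, h.2.2, h.2.1⟩
      rw [← psi_psi u', h.1, psi_psi]
    · intro h; apply h1
      simp only [Prod.mk.injEq] at h ⊢
      exact ⟨by rw [← h.1, psi_psi], h.2.2, h.2.1⟩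
  have side' : ∀ u' i' j', (u', i', j') ∈ Sq' →
      (u', i') ∈ E.erase e₀ ∧ ((φ (of j'))⁻¹ * u', i') ∈ E.erase e₀ := by
    intro u' i' j' h
    obtain ⟨h1, h2, h3⟩ := mem'.1 h
    obtain ⟨h4, h5⟩ := hS.side_of_square _ _ _ h3
    exact ⟨Finset.mem_erase.2 ⟨fun h => h1 (free1 _ _ _ h3 (Or.inl h)), h4⟩,
      Finset.mem_erase.2 ⟨fun h => h1 (free1 _ _ _ h3 (Or.inr h)), h5⟩⟩
  have hE' : ∀ e ∈ E, e ≠ e₀ → e ∈ E.erase e₀ := fun e he h => Finset.mem_erase.2 ⟨h, he⟩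
  have hEcard := Finset.card_erase_add_one he₀E
  have vert : ∀ x y : FreeGroup (Fin n), (φ x)⁻¹ * y = (φ w)⁻¹ → (φ y)⁻¹ * x = w := by
    intro x y h
    rw [← inv_map_inv_map_mul hφ, h, psi_psi]
  have hqE := hS.side_of_square _ _ _ hq
  have hb : (φ (of j))⁻¹ * u ≠ u := by
    intro h
    rw [mul_eq_right, inv_eq_one, map_eq_one_iff φ φ.injective] at h
    exact of_ne_one j h
  by_cases hsym : (u, i, j) = ((φ u)⁻¹, j, i)
  · -- The mirror image of the square is the square itself.
    simp only [Prod.mk.injEq] at hsym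
    obtain ⟨hu, rfl, -⟩ := hsym
    have hMfix : ∀ u' i', (u', i') ∈ insert (u, i) M → (φ u')⁻¹ = u' := by
      intro u' i' h
      rcases Finset.mem_insert.1 h with h | h
      · simp only [Prod.mk.injEq] at h; rw [h.1]; exact hu.symm
      · exact (hS.diag_mem _ _ h).1
    have hDiag : ∀ x y : FreeGroup (Fin n), (φ y)⁻¹ * x = u →
        Link φ (E.erase e₀) (insert (u, i) M) (x, y) (x * of i, y * of i) := fun x y h =>
      Or.inr ⟨(u, i), Finset.mem_insert_self _ _, h, rfl⟩
    have hSqcard : Sq'.card + 1 = Sq.card := by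
      rw [hSq', ← hu, Finset.erase_idem, Finset.card_erase_add_one hq]
    refine ⟨E.erase e₀, insert (u, i) M, Sq', ⟨?_, ?_, ?_, symm', side', ?_, ?_⟩, by omega⟩
    · exact fun u' i' h => hS.side_mem u' i' (Finset.mem_of_mem_erase h)
    · intro u' i' h
      refine ⟨hMfix u' i' h, ?_⟩
      rcases Finset.mem_insert.1 h with h | h
      · simp only [Prod.mk.injEq] at h
        obtain ⟨rfl, rfl⟩ := h
        exact ⟨(hS.side_mem _ _ hqE.1).1, (hS.side_mem _ _ hqE.2).2⟩
      · exact (hS.diag_mem _ _ h).2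
    · intro u' i' h h'
      rcases Finset.mem_insert.1 h with h | h
      · simp only [Prod.mk.injEq] at h
        obtain ⟨rfl, rfl⟩ := h
        exact (mem'.1 h').2.1 rfl
      · exact hS.diag_notMem _ _ h (mem'.1 h').2.2
    · intro x y hxy
      refine eqvGen_link_of_vertical hφ hMfix hE' (Finset.subset_insert _ _) ?_ (hS.conn x y hxy)
      intro x y h
      have hx := vert x y h
      rcases hnorm with ⟨h1, -⟩ | ⟨h1, -⟩
      · have hside : (u, i) ∈ E.erase e₀ := hE' _ hqE.1 (by
          intro h
          rw [he₀, h1, psi_mul, ← hu] at h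
          exact hb (congrArg Prod.fst h).symm)
        have hx' : (φ y)⁻¹ * (x * (of i)⁻¹) = u := by
          rw [← mul_assoc, hx, h1, mul_inv_cancel_right]
        have l1 : Link φ (E.erase e₀) (insert (u, i) M) (x * (of i)⁻¹, y) (x, y) :=
          Or.inl ⟨(u, i), hside, Or.inl ⟨hx', by simp⟩⟩
        have l2 := hDiag _ _ hx'
        rw [inv_mul_cancel_right] at l2
        exact (EqvGen.rel _ _ l1).symm.trans _ _ _ (.rel _ _ l2)
      · rw [h1] at hx
        have hside : ((φ (of i))⁻¹ * u, i) ∈ E.erase e₀ := hE' _ hqE.2 (by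
          intro h
          rw [he₀, h1, ← hu] at h
          exact hb (congrArg Prod.fst h))
        have l1 : Link φ (E.erase e₀) (insert (u, i) M) (x, y * of i) (x * of i, y * of i) :=
          Or.inl ⟨_, hside, Or.inl ⟨by simp only [← hx, map_mul]; group, rfl⟩⟩
        exact (EqvGen.rel _ _ (hDiag _ _ hx)).trans _ _ _ (EqvGen.rel _ _ l1).symm
    · have hnot : (u, i) ∉ M := fun h => hS.diag_notMem _ _ h hq
      rw [Finset.card_insert_of_notMem hnot]
      have := hS.card_eq
      omega
  · have hSqcard : Sq'.card + 2 = Sq.card := by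
      have h1 := Finset.card_erase_add_one hq
      have h2 := Finset.card_erase_add_one (Finset.mem_erase.2 ⟨Ne.symm hsym, hqs⟩)
      rw [← hSq'] at h2
      omega
    refine ⟨E.erase e₀, M, Sq', ⟨?_, hS.diag_mem, ?_, symm', side', ?_, ?_⟩, by omega⟩
    · exact fun u' i' h => hS.side_mem u' i' (Finset.mem_of_mem_erase h)
    · exact fun u' i' h h' => hS.diag_notMem _ _ h (mem'.1 h').2.2
    · intro x y hxy
      refine eqvGen_link_of_vertical hφ (fun u i h => (hS.diag_mem u i h).1) hE' subset_rfl ?_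
        (hS.conn x y hxy)
      intro x y h
      have hx := vert x y h
      have hs1 : (u, i) ∈ E.erase e₀ := hE' _ hqE.1 fun h => hsym (free1 _ _ _ hq (Or.inl h))
      have hs2 : ((φ (of j))⁻¹ * u, i) ∈ E.erase e₀ :=
        hE' _ hqE.2 fun h => hsym (free1 _ _ _ hq (Or.inr h))
      -- The vertical side is replaced by the three other sides of the square.
      have hpath : ∀ x, (φ y)⁻¹ * x = u →
          Link φ (E.erase e₀) M (x, y) (x * of i, y) ∧
          Link φ (E.erase e₀) M (x, y * of j) (x * of i, y * of j) := fun x hx =>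
        ⟨Or.inl ⟨_, hs1, Or.inl ⟨hx, rfl⟩⟩,
          Or.inl ⟨_, hs2, Or.inl ⟨by simp only [← hx, map_mul]; group, rfl⟩⟩⟩
      have hvert : ∀ x w', (φ y)⁻¹ * x = w' → ((φ w')⁻¹, j) ∈ E → w' ≠ w →
          Link φ (E.erase e₀) M (x, y) (x, y * of j) := fun x w' hx hE hne =>
        Or.inl ⟨_, hE' _ hE (by
          intro h
          apply hne
          rw [← psi_psi w', show (φ w')⁻¹ = (φ w)⁻¹ from congrArg Prod.fst h, psi_psi]),
          Or.inr ⟨by rw [← hx, inv_map_inv_map_mul hφ], rfl⟩⟩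
      obtain ⟨hq1, hq2⟩ := hS.side_of_square _ _ _ hqs
      rcases hnorm with ⟨h1, h2⟩ | ⟨h1, h2⟩
      · have hx' : (φ y)⁻¹ * (x * (of i)⁻¹) = u := by
          rw [← mul_assoc, hx, h1, mul_inv_cancel_right]
        obtain ⟨l1, l2⟩ := hpath _ hx'
        have l3 := hvert _ u hx' hq1 (by rw [h1]; intro h; rw [← h] at h2; omega)
        rw [inv_mul_cancel_right] at l1 l2
        exact ((EqvGen.rel _ _ l1).symm.trans _ _ _ (.rel _ _ l3)).trans _ _ _ (.rel _ _ l2)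
      · obtain ⟨l1, l2⟩ := hpath _ (hx.trans h1)
        have l3 := hvert (x * of i) (u * of i) (by rw [← mul_assoc, hx, h1])
          (by rw [psi_mul]; exact hq2) (by rw [h1]; intro h; rw [h] at h2; omega)
        exact ((EqvGen.rel _ _ l1).trans _ _ _ (.rel _ _ l3)).trans _ _ _
          (EqvGen.rel _ _ l2).symm
    · have := hS.card_eq
      omega

/-- Collapsing all squares leaves a graph. -/
theorem Stage.exists_empty (hφ : ∀ x, φ (φ x) = x) (hS : Stage φ D E M Sq) :
    ∃ E' M', Stage φ D E' M' ∅ := by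
  induction h : Sq.card using Nat.strong_induction_on generalizing E M Sq with
  | _ m ih =>
    rcases Sq.eq_empty_or_nonempty with rfl | hne
    · exact ⟨E, M, hS⟩
    · obtain ⟨E', M', Sq', hS', hlt⟩ := hS.exists_collapse hφ hne
      exact ih _ (h ▸ hlt) hS' rfl

/-- The full square complex on an invariant finite subtree `D` is a stage. It fibres over the Cayley
tree with finite subtrees as fibres, which gives its connectedness and Euler characteristic. -/
theorem exists_stage (hφ : ∀ x, φ (φ x) = x) (hD : ParentClosed (D : Set (FreeGroup (Fin n))))
    (h1 : 1 ∈ D) (hb : ∀ i, (φ (of i))⁻¹ ∈ D) (hψ : ∀ u ∈ D, (φ u)⁻¹ ∈ D) :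
    ∃ E M Sq, Stage φ D E M Sq := by
  have psi_mul := inv_map_mul φ
  have psi_mul' := inv_map_inv_map_mul hφ
  have psi_psi := inv_map_inv_map hφ
  have ha : ∀ i, of i ∈ D := fun i => by
    have := hψ _ (hb i)
    rwa [map_inv, hφ, inv_inv] at this
  set E := (D ×ˢ (Finset.univ : Finset (Fin n))).filter fun e => e.1 * of e.2 ∈ D with hE
  set B := (D ×ˢ (Finset.univ : Finset (Fin n))).filter fun e => (φ (of e.2))⁻¹ * e.1 ∈ D with hB
  set Sq := (D ×ˢ (Finset.univ : Finset (Fin n × Fin n))).filter fun q =>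
    q.1 * of q.2.1 ∈ D ∧ (φ (of q.2.2))⁻¹ * q.1 ∈ D ∧ (φ (of q.2.2))⁻¹ * q.1 * of q.2.1 ∈ D
    with hSq
  have memE : ∀ {u i}, (u, i) ∈ E ↔ u ∈ D ∧ u * of i ∈ D := by intros; simp [hE]
  have memSq : ∀ {u i j}, (u, i, j) ∈ Sq ↔ u ∈ D ∧ u * of i ∈ D ∧ (φ (of j))⁻¹ * u ∈ D ∧
      (φ (of j))⁻¹ * u * of i ∈ D := by intros; simp [hSq]
  have hEB : E.card = B.card := by
    refine Finset.card_bij (fun e _ => ((φ e.1)⁻¹, e.2)) ?_ ?_ ?_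
    · rintro ⟨u, i⟩ h
      obtain ⟨h1, h2⟩ := memE.1 h
      simp only [hB, Finset.mem_filter, Finset.mem_product, Finset.mem_univ, and_true]
      exact ⟨hψ _ h1, by rw [← psi_mul]; exact hψ _ h2⟩
    · rintro ⟨u, i⟩ - ⟨u', i'⟩ - h
      simpa using h
    · rintro ⟨u, i⟩ h
      simp only [hB, Finset.mem_filter, Finset.mem_product, Finset.mem_univ, and_true] at h
      refine ⟨((φ u)⁻¹, i), memE.2 ⟨hψ _ h.1, ?_⟩, by simp [hφ]⟩
      rw [← psi_mul']; exact hψ _ h.2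
  -- For fixed `j`, the squares are the edges of a subtree and its vertices are counted by `B`.
  have hBSq : Sq.card + n = B.card := by
    rw [Finset.card_eq_sum_card_fiberwise (f := fun q => q.2.2) (s := Sq)
        (t := Finset.univ) (fun _ _ => Finset.mem_coe.2 (Finset.mem_univ _)),
      Finset.card_eq_sum_card_fiberwise (f := fun e => e.2) (s := B)
        (t := Finset.univ) (fun _ _ => Finset.mem_coe.2 (Finset.mem_univ _))]
    have : ∑ j : Fin n, ((Sq.filter fun q => q.2.2 = j).card + 1) =
        ∑ j : Fin n, (B.filter fun e => e.2 = j).card := by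
      refine Finset.sum_congr rfl fun j _ => ?_
      set P := D.filter fun u => (φ (of j))⁻¹ * u ∈ D with hP
      have hPc : ParentClosed (P : Set (FreeGroup (Fin n))) := by
        have := hD.inter_translate (Finset.mem_coe.2 (hb j))
        simpa [hP] using this
      have hc := hPc.card_edges (by simp [hP, h1, hb])
      have e1 : (B.filter fun e => e.2 = j).card = P.card := by
        symm
        refine Finset.card_bij (fun u _ => (u, j)) ?_ ?_ ?_
        · intro u hu; simpa [hP, hB] using hu
        · intro u _ u' _ h; simpa using h
        · rintro ⟨u, j'⟩ h
          simp only [hB, Finset.mem_filter, Finset.mem_product, Finset.mem_univ,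
            and_true] at h
          obtain ⟨h, rfl⟩ := h
          exact ⟨u, by simpa [hP] using h, rfl⟩
      rw [e1, ← hc, Nat.add_right_cancel_iff]
      symm
      refine Finset.card_bij (fun e _ => (e.1, e.2, j)) ?_ ?_ ?_
      · rintro ⟨u, i⟩ h
        simp only [hP, Finset.mem_filter, Finset.mem_product, Finset.mem_univ, and_true] at h
        simp only [Finset.mem_filter, and_true]
        exact memSq.2 ⟨h.1.1, h.2.1, h.1.2, by rw [mul_assoc]; exact h.2.2⟩
      · rintro ⟨u, i⟩ - ⟨u', i'⟩ - h
        simpa using h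
      · rintro ⟨u, i, j'⟩ h
        simp only [Finset.mem_filter] at h
        obtain ⟨h, rfl⟩ := h
        obtain ⟨h1, h2, h3, h4⟩ := memSq.1 h
        refine ⟨(u, i), ?_, rfl⟩
        simp only [hP, Finset.mem_filter, Finset.mem_product, Finset.mem_univ, and_true]
        exact ⟨⟨h1, h3⟩, h2, by rw [← mul_assoc]; exact h4⟩
    rw [← this, Finset.sum_add_distrib]
    simp
  refine ⟨E, ∅, Sq, fun u i h => memE.1 h, by simp, by simp, ?_, ?_, ?_, ?_⟩
  · intro u i j h
    obtain ⟨h1, h2, h3, h4⟩ := memSq.1 h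
    refine memSq.2 ⟨hψ _ h1, by rw [← psi_mul']; exact hψ _ h3, by rw [← psi_mul]; exact hψ _ h2,
      ?_⟩
    rw [← psi_mul, ← psi_mul', ← mul_assoc]; exact hψ _ h4
  · intro u i j h
    obtain ⟨h1, h2, h3, h4⟩ := memSq.1 h
    exact ⟨memE.2 ⟨h1, h2⟩, memE.2 ⟨h3, h4⟩⟩
  · have hor : ∀ y, ∀ u ∈ D, EqvGen (Link φ E ∅) (φ y, y) (φ y * u, y) := by
      intro y
      have hlink : ∀ u i, u ∈ (D : Set _) → u * of i ∈ (D : Set _) →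
          Link φ E ∅ (φ y * u, y) (φ y * (u * of i), y) := fun u i hu hui =>
        Or.inl ⟨(u, i), memE.2 ⟨hu, hui⟩, Or.inl ⟨by simp, by rw [mul_assoc]⟩⟩
      refine hD.mem_induction ?_ ?_ ?_
      · rw [mul_one]; exact .refl _
      · exact fun u i hu hui h => h.trans _ _ _ (.rel _ _ (hlink u i hu hui))
      · exact fun u i hu hui h => h.trans _ _ _ (EqvGen.rel _ _ (hlink u i hu hui)).symm
    have hver : ∀ y i, EqvGen (Link φ E ∅) (φ y, y) (φ (y * of i), y * of i) := by
      intro y i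
      have h2 := (hor (y * of i) _ (hb i)).symm
      rw [map_mul, mul_inv_cancel_right] at h2
      rw [map_mul]
      refine EqvGen.trans _ _ _ (.rel _ _ (Or.inl ⟨(1, i), ?_, Or.inr ⟨?_, rfl⟩⟩)) h2
      · exact memE.2 ⟨h1, by rw [one_mul]; exact ha i⟩
      · simp [hφ]
    have hall : ∀ y, EqvGen (Link φ E ∅) (1, 1) (φ y, y) := by
      intro y
      refine ParentClosed.mem_induction (P := Set.univ)
        (p := fun y => EqvGen (Link φ E ∅) (1, 1) (φ y, y)) (fun _ _ _ _ => trivial) ?_ ?_ ?_ y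
        trivial
      · rw [map_one]; exact .refl _
      · exact fun u i _ _ h => h.trans _ _ _ (hver u i)
      · exact fun u i _ _ h => h.trans _ _ _ (hver u i).symm
    intro x y hxy
    have := hor y _ hxy
    rw [mul_inv_cancel_left] at this
    exact (hall y).trans _ _ _ this
  · have := hD.card_edges h1
    rw [← hE] at this
    simp only [Finset.card_empty]
    omega

end Collapse

/-! ### The quotient graph is a tree -/

section Counting

open FreeGroup hiding map_mul map_inv map_one
open Relation

variable {n : ℕ} {φ : MulAut (FreeGroup (Fin n))}

/-- The additive character of the free group taking the value `l i` on the `i`-th generator. -/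
def weight (l : Fin n → ℚ) (x : FreeGroup (Fin n)) : ℚ :=
  ∑ i, l i * (Multiplicative.toAdd (freeGroupToInt n x) i : ℤ)

theorem weight_mul (l : Fin n → ℚ) (x y : FreeGroup (Fin n)) :
    weight l (x * y) = weight l x + weight l y := by
  simp [weight, map_mul, toAdd_mul, mul_add, Finset.sum_add_distrib]

theorem weight_one (l : Fin n → ℚ) : weight l 1 = 0 := by
  have := weight_mul l 1 1
  rw [mul_one] at this
  linarith

theorem weight_inv (l : Fin n → ℚ) (x : FreeGroup (Fin n)) : weight l x⁻¹ = -weight l x := by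
  have := weight_mul l x x⁻¹
  rw [mul_inv_cancel, weight_one] at this
  linarith

theorem weight_of (l : Fin n → ℚ) (i : Fin n) : weight l (of i) = l i := by
  simp [weight, freeGroupToInt, Pi.single_apply]

theorem weight_map (hab : autToGL n φ = -1) (l : Fin n → ℚ) (x : FreeGroup (Fin n)) :
    weight l (φ x) = -weight l x := by
  have h1 : abMatrix φ.toMonoidHom = -1 := congrArg Units.val hab
  have h2 := freeGroupToInt_apply φ.toMonoidHom x
  rw [h1, Matrix.neg_mulVec, Matrix.one_mulVec] at h2
  have h3 : Multiplicative.toAdd (freeGroupToInt n (φ x)) =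
      -Multiplicative.toAdd (freeGroupToInt n x) := h2
  simp only [weight, h3, Pi.neg_apply, Int.cast_neg, mul_neg, Finset.sum_neg_distrib]

variable (φ) in
/-- The orbit of `u` under the involution `u ↦ (φ u)⁻¹`. -/
def orbitPair (u : FreeGroup (Fin n)) : Sym2 (FreeGroup (Fin n)) := s(u, (φ u)⁻¹)

theorem orbitPair_inv_map (hφ : ∀ x, φ (φ x) = x) (u : FreeGroup (Fin n)) :
    orbitPair φ (φ u)⁻¹ = orbitPair φ u := by
  rw [orbitPair, orbitPair, inv_map_inv_map hφ, Sym2.eq_swap]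

theorem orbitPair_eq_iff (hφ : ∀ x, φ (φ x) = x) {u v : FreeGroup (Fin n)} :
    orbitPair φ u = orbitPair φ v ↔ u = v ∨ u = (φ v)⁻¹ := by
  constructor
  · intro h
    have : u ∈ orbitPair φ v := by rw [← h]; exact Sym2.mem_mk_left _ _
    exact Sym2.mem_iff.1 this
  · rintro (rfl | rfl)
    · rfl
    · exact orbitPair_inv_map hφ v

/-- Counting the orbits of the involution `u ↦ (φ u)⁻¹` on an invariant finite set. -/
theorem two_mul_card_image_orbitPair (hφ : ∀ x, φ (φ x) = x) {D : Finset (FreeGroup (Fin n))}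
    (hψ : ∀ u ∈ D, (φ u)⁻¹ ∈ D) :
    2 * (D.image (orbitPair φ)).card = D.card + (D.filter fun u => (φ u)⁻¹ = u).card := by
  rw [Finset.card_eq_sum_card_fiberwise (f := orbitPair φ) (s := D) (t := D.image (orbitPair φ))
      (fun u hu => Finset.mem_coe.2 (Finset.mem_image_of_mem _ hu)),
    Finset.card_eq_sum_card_fiberwise (f := orbitPair φ) (s := D.filter _)
      (t := D.image (orbitPair φ))
      (fun u hu => Finset.mem_coe.2 (Finset.mem_image_of_mem _ (Finset.mem_filter.1 hu).1)),
    ← Finset.sum_add_distrib, mul_comm, ← smul_eq_mul, ← Finset.sum_const]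
  refine Finset.sum_congr rfl fun k hk => ?_
  obtain ⟨u, hu, rfl⟩ := Finset.mem_image.1 hk
  have h1 : (D.filter fun v => orbitPair φ v = orbitPair φ u) = {u, (φ u)⁻¹} := by
    ext v
    simp only [Finset.mem_filter, Finset.mem_insert, Finset.mem_singleton,
      orbitPair_eq_iff hφ]
    exact ⟨fun h => h.2, fun h => ⟨by rcases h with rfl | rfl; exacts [hu, hψ _ hu], h⟩⟩
  rw [Finset.filter_filter, Finset.filter_congr (fun _ _ => and_comm), ← Finset.filter_filter, h1]
  by_cases hfix : (φ u)⁻¹ = u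
  · rw [hfix, Finset.pair_eq_singleton, Finset.filter_singleton, if_pos hfix]
    rfl
  · rw [Finset.card_pair (Ne.symm hfix), Finset.filter_eq_empty_iff.2]
    · rfl
    · intro v hv
      rcases Finset.mem_insert.1 hv with rfl | hv
      · exact hfix
      · rw [Finset.mem_singleton.1 hv, inv_map_inv_map hφ]
        exact Ne.symm hfix

section LinearAlgebra

variable {D : Finset (FreeGroup (Fin n))} {E M : Finset (FreeGroup (Fin n) × Fin n)}

/-- The coboundary of a function on the vertices of the quotient graph, twisted by a character of
the free group; its components are the values on the horizontal and the vertical sides and on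
the diagonals. -/
def twistedCoboundary (hS : Stage φ D E M ∅) (hψ : ∀ u ∈ D, (φ u)⁻¹ ∈ D) :
    ((D → ℚ) × (Fin n → ℚ)) →ₗ[ℚ] (E → ℚ) × (E → ℚ) × (M → ℚ) where
  toFun fl :=
    (fun e => fl.1 ⟨e.1.1 * of e.1.2, (hS.side_mem _ _ e.2).2⟩ -
        fl.1 ⟨e.1.1, (hS.side_mem _ _ e.2).1⟩,
      fun e => fl.1 ⟨(φ (e.1.1 * of e.1.2))⁻¹, hψ _ (hS.side_mem _ _ e.2).2⟩ -
        fl.1 ⟨(φ e.1.1)⁻¹, hψ _ (hS.side_mem _ _ e.2).1⟩ - fl.2 e.1.2,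
      fun e => fl.1 ⟨(φ (of e.1.2))⁻¹ * e.1.1 * of e.1.2, (hS.diag_mem _ _ e.2).2.2⟩ -
        fl.1 ⟨e.1.1, (hS.diag_mem _ _ e.2).2.1⟩ - fl.2 e.1.2)
  map_add' fl fl' := by
    ext e <;> simp only [Prod.fst_add, Prod.snd_add, Pi.add_apply] <;> ring
  map_smul' c fl := by
    ext e <;> simp only [Prod.smul_fst, Prod.smul_snd, Pi.smul_apply, smul_eq_mul,
      RingHom.id_apply] <;> ring

/-- The kernel of the twisted coboundary consists of the constants since the graph upstairs is
connected. -/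
theorem twistedCoboundary_ker_le (hφ : ∀ x, φ (φ x) = x) (hS : Stage φ D E M ∅)
    (hψ : ∀ u ∈ D, (φ u)⁻¹ ∈ D) (h1 : 1 ∈ D) :
    LinearMap.ker (twistedCoboundary hS hψ) ≤ Submodule.span ℚ {(fun _ => 1, 0)} := by
  rintro ⟨f, l⟩ hfl
  rw [LinearMap.mem_ker] at hfl
  have hor : ∀ e : E, f ⟨e.1.1 * of e.1.2, (hS.side_mem _ _ e.2).2⟩ =
      f ⟨e.1.1, (hS.side_mem _ _ e.2).1⟩ := fun e =>
    sub_eq_zero.1 (congrFun (congrArg Prod.fst hfl) e)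
  have ver : ∀ e : E, f ⟨(φ (e.1.1 * of e.1.2))⁻¹, hψ _ (hS.side_mem _ _ e.2).2⟩ =
      f ⟨(φ e.1.1)⁻¹, hψ _ (hS.side_mem _ _ e.2).1⟩ + l e.1.2 := fun e => by
    have : _ - _ - l e.1.2 = 0 := congrFun (congrArg (fun z => z.2.1) hfl) e
    linarith
  have diag : ∀ e : M, f ⟨(φ (of e.1.2))⁻¹ * e.1.1 * of e.1.2, (hS.diag_mem _ _ e.2).2.2⟩ =
      f ⟨e.1.1, (hS.diag_mem _ _ e.2).2.1⟩ + l e.1.2 := fun e => by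
    have : _ - _ - l e.1.2 = 0 := congrFun (congrArg (fun z => z.2.2) hfl) e
    linarith
  -- The potential function upstairs, with value zero outside the complex.
  let f' : FreeGroup (Fin n) → ℚ := fun u => if h : u ∈ D then f ⟨u, h⟩ else 0
  have hf' : ∀ u (h : u ∈ D), f' u = f ⟨u, h⟩ := fun u h => dif_pos h
  let P : FreeGroup (Fin n) × FreeGroup (Fin n) → ℚ := fun p =>
    f' ((φ p.2)⁻¹ * p.1) - weight l p.2
  have hP : ∀ p q, EqvGen (Link φ E M) p q → P p = P q := by
    intro p q h
    induction h with
    | refl x => rfl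
    | symm x y _ ih => exact ih.symm
    | trans x y z _ _ h1 h2 => exact h1.trans h2
    | rel p q h =>
      obtain ⟨x, y⟩ := p
      rcases h with ⟨⟨u, i⟩, he, ⟨h, rfl⟩ | ⟨h, rfl⟩⟩ | ⟨⟨u, i⟩, he, h, rfl⟩ <;>
        dsimp only at h
      · have h2 := hor ⟨(u, i), he⟩
        rw [← hf', ← hf'] at h2
        simp only [P]
        rw [← mul_assoc, h]
        dsimp only at h2
        rw [h2]
      · have h2 := ver ⟨(u, i), he⟩
        rw [← hf', ← hf'] at h2
        simp only [P]
        have h3 : (φ y)⁻¹ * x = (φ u)⁻¹ := by rw [← h, inv_map_inv_map_mul hφ]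
        rw [weight_mul, weight_of, map_mul, mul_inv_rev, mul_assoc, h3]
        dsimp only at h2
        rw [inv_map_mul] at h2
        rw [h2]
        ring
      · have h2 := diag ⟨(u, i), he⟩
        rw [← hf', ← hf'] at h2
        simp only [P]
        have h3 : (φ (y * of i))⁻¹ * (x * of i) = (φ (of i))⁻¹ * u * of i := by
          rw [← h, map_mul]; group
        rw [weight_mul, weight_of, h3, h]
        dsimp only at h2
        rw [h2]
        ring
  have hl : l = 0 := by
    funext i
    have := hP _ _ (hS.conn (φ (of i)) (of i) (by rwa [inv_mul_cancel]))
    simp only [P, map_one, inv_one, mul_one, inv_mul_cancel, weight_one, weight_of] at this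
    rw [Pi.zero_apply]
    linarith
  subst hl
  have hf : ∀ u, f u = f ⟨1, h1⟩ := by
    rintro ⟨u, hu⟩
    have := hP _ _ (hS.conn u 1 (by simpa using hu))
    simp only [P, map_one, inv_one, mul_one, one_mul, weight_one] at this
    rw [hf' _ h1, hf' _ hu] at this
    linarith
  refine Submodule.mem_span_singleton.2 ⟨f ⟨1, h1⟩, ?_⟩
  ext u
  · simp [hf u]
  · simp

/-- Surjectivity of the twisted coboundary follows from the Euler characteristic. -/
theorem twistedCoboundary_surjective (hφ : ∀ x, φ (φ x) = x) (hS : Stage φ D E M ∅)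
    (hψ : ∀ u ∈ D, (φ u)⁻¹ ∈ D) (h1 : 1 ∈ D) :
    Function.Surjective (twistedCoboundary hS hψ) := by
  rw [← LinearMap.range_eq_top]
  apply Submodule.eq_top_of_finrank_eq
  have hker := (Submodule.finrank_mono (twistedCoboundary_ker_le hφ hS hψ h1)).trans
    (finrank_span_le_card _)
  have hrn := (twistedCoboundary hS hψ).finrank_range_add_finrank_ker
  rw [Set.toFinset_singleton, Finset.card_singleton] at hker
  have hle := Submodule.finrank_le (LinearMap.range (twistedCoboundary hS hψ))
  simp only [Module.finrank_prod, Module.finrank_fintype_fun_eq_card, Fintype.card_coe,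
    Fintype.card_fin] at hrn hle ⊢
  have := hS.card_eq
  rw [Finset.card_empty] at this
  omega

/-- The quotient graph has more vertices than edges, and so is a tree: every function on its edges is
a coboundary. A function on the edges upstairs that is invariant under the swap is a twisted
coboundary, and the twist can be removed because `φ` acts on characters by `-1`. -/
theorem Stage.card_add_card_lt (hφ : ∀ x, φ (φ x) = x) (hab : autToGL n φ = -1)
    (hS : Stage φ D E M ∅) (hψ : ∀ u ∈ D, (φ u)⁻¹ ∈ D) (h1 : 1 ∈ D) :
    E.card + M.card + 1 ≤ (D.image (orbitPair φ)).card := by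
  let cls : D → D.image (orbitPair φ) := fun u => ⟨orbitPair φ u, Finset.mem_image_of_mem _ u.2⟩
  let Ψ : (D.image (orbitPair φ) → ℚ) →ₗ[ℚ] (E → ℚ) × (M → ℚ) :=
    { toFun := fun g =>
        (fun e => g (cls ⟨e.1.1 * of e.1.2, (hS.side_mem _ _ e.2).2⟩) -
            g (cls ⟨e.1.1, (hS.side_mem _ _ e.2).1⟩),
          fun e => g (cls ⟨(φ (of e.1.2))⁻¹ * e.1.1 * of e.1.2, (hS.diag_mem _ _ e.2).2.2⟩) -
            g (cls ⟨e.1.1, (hS.diag_mem _ _ e.2).2.1⟩))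
      map_add' := fun g g' => by
        ext e <;> simp only [Prod.fst_add, Prod.snd_add, Pi.add_apply] <;> ring
      map_smul' := fun c g => by
        ext e <;> simp only [Prod.smul_fst, Prod.smul_snd, Pi.smul_apply, smul_eq_mul,
          RingHom.id_apply] <;> ring }
  have hsurj : Function.Surjective Ψ := by
    rintro ⟨w, m⟩
    obtain ⟨⟨f, l⟩, hfl⟩ := twistedCoboundary_surjective hφ hS hψ h1 (w, w, m)
    -- Symmetrizing leaves a multiple of the character, which is itself invariant and therefore
    -- can be subtracted.
    let F : D → ℚ := fun u => (f u + f ⟨(φ u)⁻¹, hψ _ u.2⟩ - weight l u) / 2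
    have wψ : ∀ u, weight l (φ u)⁻¹ = weight l u := fun u => by
      rw [weight_inv, weight_map hab, neg_neg]
    have hF : ∀ u, F ⟨(φ u.1)⁻¹, hψ _ u.2⟩ = F u := by
      rintro ⟨u, hu⟩
      simp only [F, wψ, inv_map_inv_map hφ]
      ring
    have hcls : ∀ u v, cls u = cls v → F u = F v := by
      intro u v h
      rcases (orbitPair_eq_iff hφ).1 (congrArg Subtype.val h) with h | h
      · rw [Subtype.ext h]
      · rw [← hF v]; congr 1; exact Subtype.ext h
    have hsurj : Function.Surjective cls := by
      rintro ⟨k, hk⟩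
      obtain ⟨u, hu, rfl⟩ := Finset.mem_image.1 hk
      exact ⟨⟨u, hu⟩, rfl⟩
    let g : D.image (orbitPair φ) → ℚ := fun k => F (Function.surjInv hsurj k)
    have hg : ∀ u, g (cls u) = F u := fun u => hcls _ _ (Function.surjInv_eq hsurj _)
    refine ⟨g, ?_⟩
    ext ⟨⟨u, i⟩, he⟩
    · have h2 : _ - _ = w ⟨(u, i), he⟩ := congrFun (congrArg Prod.fst hfl) ⟨(u, i), he⟩
      have h3 : _ - _ - _ = w ⟨(u, i), he⟩ :=
        congrFun (congrArg (fun z => z.2.1) hfl) ⟨(u, i), he⟩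
      change g (cls _) - g (cls _) = _
      rw [hg, hg]
      dsimp only [F] at h2 h3 ⊢
      rw [weight_mul, weight_of]
      linarith
    · have h2 : _ - _ - _ = m ⟨(u, i), he⟩ :=
        congrFun (congrArg (fun z => z.2.2) hfl) ⟨(u, i), he⟩
      change g (cls _) - g (cls _) = _
      have hu := (hS.diag_mem _ _ he).1
      have hu' : (φ ((φ (of i))⁻¹ * u * of i))⁻¹ = (φ (of i))⁻¹ * u * of i := by
        rw [inv_map_mul, inv_map_inv_map_mul hφ, hu, mul_assoc]
      rw [hg, hg]
      dsimp only [F] at h2 ⊢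
      simp only [hu, hu']
      rw [weight_mul, weight_mul, weight_inv, weight_map hab, weight_of]
      linarith
  have hker : 0 < Module.finrank ℚ (LinearMap.ker Ψ) := by
    have hmem : (fun _ => 1 : D.image (orbitPair φ) → ℚ) ∈ LinearMap.ker Ψ := by
      rw [LinearMap.mem_ker]
      ext e
      · exact sub_self (1 : ℚ)
      · exact sub_self (1 : ℚ)
    rw [Module.finrank_pos_iff_exists_ne_zero]
    refine ⟨⟨_, hmem⟩, fun h => ?_⟩
    have := congrFun (congrArg Subtype.val h) (cls ⟨1, h1⟩)
    exact one_ne_zero this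
  have hrn := Ψ.finrank_range_add_finrank_ker
  rw [LinearMap.range_eq_top.2 hsurj, finrank_top] at hrn
  simp only [Module.finrank_prod, Module.finrank_fintype_fun_eq_card, Fintype.card_coe] at hrn
  omega

end LinearAlgebra

end Counting

/-! ### The group acting on the product of two trees -/

section SwapGroup

open FreeGroup hiding map_mul map_inv map_one
open Relation MulAction

variable {n : ℕ} {φ : MulAut (FreeGroup (Fin n))}

variable (φ) in
/-- The diagonal action of the free group on pairs, twisted by `φ` in the second coordinate. -/
def shift : FreeGroup (Fin n) →* Equiv.Perm (FreeGroup (Fin n) × FreeGroup (Fin n)) where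
  toFun f := (Equiv.mulLeft f).prodCongr (Equiv.mulLeft (φ f))
  map_one' := by ext p <;> simp
  map_mul' f g := by ext p <;> simp [mul_assoc]

theorem shift_apply (f : FreeGroup (Fin n)) (p : FreeGroup (Fin n) × FreeGroup (Fin n)) :
    shift φ f p = (f * p.1, φ f * p.2) := rfl

/-- The exchange of the two coordinates. -/
def swapPerm : Equiv.Perm (FreeGroup (Fin n) × FreeGroup (Fin n)) := Equiv.prodComm _ _

theorem swapPerm_apply (p : FreeGroup (Fin n) × FreeGroup (Fin n)) : swapPerm p = p.swap := rfl

theorem swapPerm_mul_self : swapPerm (n := n) * swapPerm = 1 := by ext p <;> rfl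

theorem shift_mul_swapPerm (hφ : ∀ x, φ (φ x) = x) (f : FreeGroup (Fin n)) :
    shift φ f * swapPerm = swapPerm * shift φ (φ f) := by
  ext p <;> simp [shift_apply, swapPerm_apply, hφ]

/-- The group generated by the exchange of coordinates and the twisted diagonal action of a
subgroup invariant under `φ`. If the rank is positive and the subgroup is everything, then this
is the semidirect product of the free group with the group of order two acting through `φ`. -/
def swapGroup (hφ : ∀ x, φ (φ x) = x) (H : Subgroup (FreeGroup (Fin n)))
    (hH : ∀ f ∈ H, φ f ∈ H) : Subgroup (Equiv.Perm (FreeGroup (Fin n) × FreeGroup (Fin n))) where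
  carrier := {g | ∃ f ∈ H, g = shift φ f ∨ g = swapPerm * shift φ f}
  one_mem' := ⟨1, H.one_mem, Or.inl (map_one _).symm⟩
  mul_mem' := by
    rintro _ _ ⟨f, hf, rfl | rfl⟩ ⟨f', hf', rfl | rfl⟩
    · exact ⟨f * f', H.mul_mem hf hf', Or.inl (map_mul _ _ _).symm⟩
    · refine ⟨φ f * f', H.mul_mem (hH f hf) hf', Or.inr ?_⟩
      rw [← mul_assoc, shift_mul_swapPerm hφ, map_mul, mul_assoc]
    · refine ⟨f * f', H.mul_mem hf hf', Or.inr ?_⟩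
      rw [map_mul, mul_assoc]
    · refine ⟨φ f * f', H.mul_mem (hH f hf) hf', Or.inl ?_⟩
      rw [mul_assoc, ← mul_assoc (shift φ f), shift_mul_swapPerm hφ, map_mul, mul_assoc,
        ← mul_assoc, swapPerm_mul_self, one_mul]
  inv_mem' := by
    rintro _ ⟨f, hf, rfl | rfl⟩
    · exact ⟨f⁻¹, H.inv_mem hf, Or.inl (map_inv _ _).symm⟩
    · refine ⟨φ f⁻¹, hH _ (H.inv_mem hf), Or.inr ?_⟩
      rw [← shift_mul_swapPerm hφ, mul_inv_rev, map_inv, inv_eq_of_mul_eq_one_left swapPerm_mul_self]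

theorem swapPerm_mul_shift_ne_shift (i : Fin n) (f f' : FreeGroup (Fin n)) :
    swapPerm * shift φ f ≠ shift φ f' := by
  intro h
  have h1 := congrArg Prod.fst (DFunLike.congr_fun h (1, 1))
  have h2 := congrArg Prod.fst (DFunLike.congr_fun h (1, of i))
  simp only [Equiv.Perm.mul_apply, shift_apply, swapPerm_apply, Prod.fst_swap, mul_one] at h1 h2
  rw [← h1, mul_eq_left] at h2
  exact of_ne_one i h2

variable (φ) in
/-- The label of a vertex of the product of trees, a complete invariant of its orbit under the
free group. -/
def vertexLabel (p : FreeGroup (Fin n) × FreeGroup (Fin n)) : FreeGroup (Fin n) :=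
  (φ p.2)⁻¹ * p.1

theorem vertexLabel_shift (hφ : ∀ x, φ (φ x) = x) (f : FreeGroup (Fin n))
    (p : FreeGroup (Fin n) × FreeGroup (Fin n)) :
    vertexLabel φ (shift φ f p) = vertexLabel φ p := by
  simp only [vertexLabel, shift_apply, map_mul, hφ]
  group

theorem vertexLabel_swap (hφ : ∀ x, φ (φ x) = x) (p : FreeGroup (Fin n) × FreeGroup (Fin n)) :
    vertexLabel φ p.swap = (φ (vertexLabel φ p))⁻¹ :=
  (inv_map_inv_map_mul hφ _ _).symm

theorem exists_shift_of_vertexLabel_eq (hφ : ∀ x, φ (φ x) = x)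
    {p q : FreeGroup (Fin n) × FreeGroup (Fin n)} (h : vertexLabel φ p = vertexLabel φ q) :
    ∃ f, q = shift φ f p := by
  refine ⟨q.1 * p.1⁻¹, ?_⟩
  have h' := congrArg (fun u => (φ u)⁻¹) h
  simp only [vertexLabel, inv_map_inv_map_mul hφ] at h'
  refine Prod.ext ?_ ?_ <;> rw [shift_apply] <;> dsimp only
  · rw [inv_mul_cancel_right]
  · rw [map_mul, map_inv, mul_assoc, h', mul_inv_cancel_left]

/-- A horizontal or vertical side is, up to the exchange of coordinates, horizontal. -/
theorem side_iff {e : FreeGroup (Fin n) × Fin n}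
    {p q : FreeGroup (Fin n) × FreeGroup (Fin n)} :
    Side φ e p q ↔ ∃ s : Equiv.Perm (FreeGroup (Fin n) × FreeGroup (Fin n)),
      (s = 1 ∨ s = swapPerm) ∧
        vertexLabel φ (s p) = e.1 ∧ s q = ((s p).1 * of e.2, (s p).2) := by
  constructor
  · rintro (⟨h, rfl⟩ | ⟨h, rfl⟩)
    · exact ⟨1, Or.inl rfl, h, rfl⟩
    · exact ⟨swapPerm, Or.inr rfl, h, rfl⟩
  · rintro ⟨s, rfl | rfl, h, h'⟩
    · exact Or.inl ⟨h, h'⟩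
    · refine Or.inr ⟨h, ?_⟩
      rw [← Prod.swap_swap q, ← swapPerm_apply q, h']
      rfl

theorem shift_side (hφ : ∀ x, φ (φ x) = x) {e : FreeGroup (Fin n) × Fin n}
    {p q : FreeGroup (Fin n) × FreeGroup (Fin n)} (h : Side φ e p q) (f : FreeGroup (Fin n)) :
    Side φ e (shift φ f p) (shift φ f q) := by
  rcases h with ⟨h, rfl⟩ | ⟨h, rfl⟩
  · exact Or.inl ⟨(vertexLabel_shift hφ f p).trans h, by simp [shift_apply, mul_assoc]⟩
  · refine Or.inr ⟨?_, by simp [shift_apply, mul_assoc]⟩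
    rw [← h, shift_apply]
    simp only [map_mul]
    group

theorem shift_diagonal (hφ : ∀ x, φ (φ x) = x) {e : FreeGroup (Fin n) × Fin n}
    {p q : FreeGroup (Fin n) × FreeGroup (Fin n)} (h : Diagonal φ e p q)
    (f : FreeGroup (Fin n)) : Diagonal φ e (shift φ f p) (shift φ f q) :=
  ⟨(vertexLabel_shift hφ f p).trans h.1, by rw [h.2]; simp [shift_apply, mul_assoc]⟩

/-- A nontrivial stabilizer is generated by an involution exchanging the coordinates. -/
theorem eq_of_fixes (hφ : ∀ x, φ (φ x) = x) {g : Equiv.Perm (FreeGroup (Fin n) × FreeGroup (Fin n))}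
    (hg : g ∈ swapGroup hφ ⊤ (fun _ _ => trivial))
    {p : FreeGroup (Fin n) × FreeGroup (Fin n)} (hp : g p = p) :
    g = 1 ∨ g = swapPerm * shift φ (p.2 * p.1⁻¹) ∧ φ (p.2 * p.1⁻¹) = (p.2 * p.1⁻¹)⁻¹ := by
  obtain ⟨f, -, rfl | rfl⟩ := hg
  · left
    have := congrArg Prod.fst hp
    rw [shift_apply] at this
    rw [mul_eq_right.1 this, map_one]
  · right
    have h1 : f * p.1 = p.2 := congrArg Prod.snd hp
    have h2 : φ f * p.2 = p.1 := congrArg Prod.fst hp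
    have h3 : f = p.2 * p.1⁻¹ := eq_mul_inv_of_mul_eq h1
    rw [← h3]
    refine ⟨rfl, ?_⟩
    rw [eq_mul_inv_of_mul_eq h2, h3, mul_inv_rev, inv_inv]

theorem swapPerm_mul_shift_fixes (hφ : ∀ x, φ (φ x) = x)
    {p : FreeGroup (Fin n) × FreeGroup (Fin n)}
    (hp : (φ (vertexLabel φ p))⁻¹ = vertexLabel φ p) :
    (swapPerm * shift φ (p.2 * p.1⁻¹) : Equiv.Perm _) p = p := by
  rw [vertexLabel, inv_map_inv_map_mul hφ] at hp
  rw [Equiv.Perm.mul_apply, shift_apply, swapPerm_apply]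
  ext
  · simp only [Prod.fst_swap, map_mul, map_inv]
    rw [mul_assoc, hp, mul_inv_cancel_left]
  · simp

end SwapGroup

/-! ### Generation by inverted elements -/

section Generation

open FreeGroup hiding map_mul map_inv map_one
open Relation MulAction

variable {n : ℕ} {φ : MulAut (FreeGroup (Fin n))}

/-- The free group is generated by `n` elements that `φ` inverts: the group of all shifts and swaps
acts on the graph left by the collapse, the quotient is a tree, and the stabilizers that generate
the group have order two, one of them being generated by the swap. -/
theorem exists_inverted_generators (hφ : ∀ x, φ (φ x) = x) (hab : autToGL n φ = -1) (i₀ : Fin n) :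
    ∃ y : Fin n → FreeGroup (Fin n), (∀ i, φ (y i) = (y i)⁻¹) ∧
      Subgroup.closure (Set.range y) = ⊤ := by
  classical
  obtain ⟨D, hD, h1, hb, hψ⟩ := exists_finite_invariant_subtree hφ
  obtain ⟨E, M, Sq, hS⟩ := exists_stage hφ hD h1 hb hψ
  obtain ⟨E, M, hS⟩ := hS.exists_empty hφ
  have hcount := hS.card_add_card_lt hφ hab hψ h1
  have hcard := hS.card_eq
  have hfix := two_mul_card_image_orbitPair hφ hψ
  rw [Finset.card_empty] at hcard
  let V := FreeGroup (Fin n) × FreeGroup (Fin n)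
  let G := swapGroup hφ ⊤ (fun _ _ => trivial)
  have hshift : ∀ f, shift φ f ∈ G := fun f => ⟨f, trivial, Or.inl rfl⟩
  have hswap : swapPerm ∈ G := ⟨1, trivial, Or.inr (by rw [map_one, mul_one])⟩
  let R : E ⊕ M → V → V → Prop := Sum.elim (fun e => Side φ e.1) (fun e => Diagonal φ e.1)
  let cls : V → Sym2 (FreeGroup (Fin n)) := fun p => orbitPair φ (vertexLabel φ p)
  let K := D.image (orbitPair φ)
  have hR : ∀ p q, Link φ E M p q → ∃ i, R i p q := by
    rintro p q (⟨e, he, h⟩ | ⟨e, he, h⟩)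
    · exact ⟨Sum.inl ⟨e, he⟩, h⟩
    · exact ⟨Sum.inr ⟨e, he⟩, h⟩
  have hR' : ∀ i p q, R i p q → Link φ E M p q := by
    rintro (⟨e, he⟩ | ⟨e, he⟩) p q h
    · exact Or.inl ⟨e, he, h⟩
    · exact Or.inr ⟨e, he, h⟩
  have hMfix : ∀ u i, (u, i) ∈ M → (φ u)⁻¹ = u := fun u i h => (hS.diag_mem u i h).1
  have hconnR : ∀ p, vertexLabel φ p ∈ D → EqvGen (fun p q => ∃ i, R i p q) (1, 1) p :=
    fun p hp => (hS.conn p.1 p.2 hp).mono hR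
  have hinv : ∀ i (g : G) p q, R i p q → R i (g • p) (g • q) := by
    rintro i ⟨_, f, -, rfl | rfl⟩ p q h
    · rcases i with e | e
      · exact shift_side hφ h f
      · exact shift_diagonal hφ h f
    · rcases i with ⟨e, he⟩ | ⟨⟨u, i⟩, he⟩
      · rcases shift_side hφ h f with h | h
        · exact Or.inr ⟨h.1, by rw [← Prod.swap_inj]; exact h.2⟩
        · exact Or.inl ⟨h.1, by rw [← Prod.swap_inj]; exact h.2⟩
      · have h' := shift_diagonal hφ h f
        refine ⟨?_, by rw [← Prod.swap_inj]; exact h'.2⟩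
        have := vertexLabel_swap hφ (shift φ f p)
        rw [show vertexLabel φ (shift φ f p) = u from h'.1, hMfix u i he] at this
        exact this
  have hcls : ∀ p q : V, cls p = cls q ↔ ∃ g : G, q = g • p := by
    intro p q
    constructor
    · intro h
      rcases (orbitPair_eq_iff hφ).1 h with h | h
      · obtain ⟨f, hf⟩ := exists_shift_of_vertexLabel_eq hφ h
        exact ⟨⟨_, hshift f⟩, hf⟩
      · rw [← vertexLabel_swap hφ] at h
        obtain ⟨f, hf⟩ := exists_shift_of_vertexLabel_eq hφ h
        exact ⟨⟨_, G.mul_mem hswap (hshift f)⟩, Prod.swap_inj.1 hf⟩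
    · rintro ⟨⟨_, f, -, rfl | rfl⟩, rfl⟩
      · change orbitPair φ _ = orbitPair φ (vertexLabel φ (shift φ f p))
        rw [vertexLabel_shift hφ]
      · change orbitPair φ _ = orbitPair φ (vertexLabel φ (shift φ f p).swap)
        rw [vertexLabel_swap hφ, vertexLabel_shift hφ, orbitPair_inv_map hφ]
  have htr : ∀ i p q p' q', R i p q → R i p' q' → ∃ g : G, p' = g • p ∧ q' = g • q := by
    rintro (e | e) p q p' q' h h'
    · obtain ⟨s, hs, h1, h2⟩ := side_iff.1 h
      obtain ⟨s', hs', h1', h2'⟩ := side_iff.1 h'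
      have hsG : ∀ s : Equiv.Perm V, s = 1 ∨ s = swapPerm → s ∈ G := by
        rintro s (rfl | rfl)
        exacts [G.one_mem, hswap]
      obtain ⟨f, hf⟩ := exists_shift_of_vertexLabel_eq hφ (h1.trans h1'.symm)
      refine ⟨⟨_, G.mul_mem (G.mul_mem (G.inv_mem (hsG s' hs')) (hshift f)) (hsG s hs)⟩, ?_, ?_⟩
      · exact Equiv.Perm.eq_inv_iff_eq.2 hf
      · refine Equiv.Perm.eq_inv_iff_eq.2 ?_
        rw [h2', h2, hf]
        simp [shift_apply, mul_assoc]
    · obtain ⟨f, hf⟩ := exists_shift_of_vertexLabel_eq hφ (h.1.trans h'.1.symm)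
      refine ⟨⟨_, hshift f⟩, hf, ?_⟩
      rw [h.2, h'.2, hf]
      change _ = shift φ f _
      simp [shift_apply, mul_assoc]
  have hstab : ∀ p : V, (φ (vertexLabel φ p))⁻¹ = vertexLabel φ p → stabilizer G p ≠ ⊥ := by
    intro p hp h
    have : (⟨_, G.mul_mem hswap (hshift (p.2 * p.1⁻¹))⟩ : G) ∈ stabilizer G p :=
      swapPerm_mul_shift_fixes hφ hp
    rw [h, Subgroup.mem_bot] at this
    refine swapPerm_mul_shift_ne_shift (φ := φ) i₀ (p.2 * p.1⁻¹) 1 ?_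
    rw [map_one]
    exact congrArg Subtype.val this
  have hstab' : ∀ p : V, stabilizer G p ≠ ⊥ →
      φ (p.2 * p.1⁻¹) = (p.2 * p.1⁻¹)⁻¹ := by
    intro p hp
    obtain ⟨g, hg1⟩ := Subgroup.ne_bot_iff_exists_ne_one.1 hp
    rcases eq_of_fixes hφ g.1.2 g.2 with h | h
    · exact absurd (Subtype.ext (Subtype.ext h)) hg1
    · exact h.2
  have hfixlab : ∀ p : V, φ (p.2 * p.1⁻¹) = (p.2 * p.1⁻¹)⁻¹ →
      (φ (vertexLabel φ p))⁻¹ = vertexLabel φ p := by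
    intro p hp
    rw [map_mul, map_inv, mul_inv_rev, inv_inv, mul_inv_eq_iff_eq_mul] at hp
    rw [vertexLabel, inv_map_inv_map_mul hφ, hp]
    group
  let M' : Finset (E ⊕ M) := Finset.univ.map Function.Embedding.inr
  have hM'card : M'.card = M.card := by simp [M']
  have hM : ∀ i ∈ M', ∀ p q, R i p q → stabilizer G p = stabilizer G q ∧ stabilizer G p ≠ ⊥ := by
    rintro i hi p q h
    obtain ⟨⟨⟨u, i⟩, he⟩, -, rfl⟩ := Finset.mem_map.1 hi
    refine ⟨?_, hstab p ?_⟩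
    · have hright : ∀ g : G, g • q = ((g • p).1 * of i, (g • p).2 * of i) := by
        rw [h.2]
        rintro ⟨_, f, -, rfl | rfl⟩
        · change shift φ f _ = ((shift φ f p).1 * of i, (shift φ f p).2 * of i)
          simp [shift_apply, mul_assoc]
        · change (shift φ f _).swap = ((shift φ f p).swap.1 * of i, (shift φ f p).swap.2 * of i)
          simp [shift_apply, mul_assoc]
      ext g
      rw [mem_stabilizer_iff, mem_stabilizer_iff, hright, h.2, Prod.ext_iff, Prod.ext_iff]
      simp
    · rw [show vertexLabel φ p = u from h.1]
      exact hMfix u i he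
  have hKmem : ∀ p : V, vertexLabel φ p ∈ D → cls p ∈ K := fun p hp =>
    Finset.mem_image_of_mem _ hp
  have hKswap : ∀ p : V, vertexLabel φ p.swap ∈ D → cls p ∈ K := fun p hp => by
    have := hψ _ hp
    rw [vertexLabel_swap hφ, inv_map_inv_map hφ] at this
    exact hKmem p this
  have hK : ∀ i p q, R i p q → cls p ∈ K ∧ cls q ∈ K := by
    rintro (⟨⟨u, i⟩, he⟩ | ⟨⟨u, i⟩, he⟩) ⟨x, y⟩ q h
    · obtain ⟨h1, h2⟩ := hS.side_mem u i he
      rcases h with ⟨h, rfl⟩ | ⟨h, rfl⟩ <;> dsimp only at h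
      · refine ⟨hKmem _ (by rw [vertexLabel, h]; exact h1), hKmem _ ?_⟩
        rw [vertexLabel, ← mul_assoc, h]
        exact h2
      · refine ⟨hKswap _ (by rw [vertexLabel, Prod.swap, h]; exact h1), hKswap _ ?_⟩
        rw [vertexLabel]
        simp only [Prod.swap]
        rw [← mul_assoc, h]
        exact h2
    · obtain ⟨-, h1, h2⟩ := hS.diag_mem u i he
      obtain ⟨h, rfl⟩ := h
      dsimp only at h
      refine ⟨hKmem _ (by rw [vertexLabel, h]; exact h1), hKmem _ ?_⟩
      have : vertexLabel φ (x * of i, y * of i) = (φ (of i))⁻¹ * u * of i := by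
        rw [vertexLabel, ← h]; simp only [map_mul]; group
      rw [this]
      exact h2
  have hlab1 : vertexLabel φ ((1, 1) : V) = 1 := by simp [vertexLabel]
  obtain ⟨heq, X, hX₀, hXstab, hXtop, hXcard⟩ :=
    exists_generating_stabilizers (R := R) (cls := cls) (K := K) (M := M') (v₀ := (1, 1))
      hinv htr hcls hM hK (hKmem _ (by rw [hlab1]; exact h1)) (hstab _ (by simp [hlab1]))
      (by
        intro k hk
        obtain ⟨u, hu, rfl⟩ := Finset.mem_image.1 hk
        have : vertexLabel φ (u, 1) = u := by simp [vertexLabel]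
        exact ⟨(u, 1), hconnR _ (by rwa [this]), by simp only [cls, this]⟩)
      (by
        rintro ⟨_, f, -, rfl | rfl⟩
        · refine hconnR _ ?_
          change vertexLabel φ (shift φ f (1, 1)) ∈ D
          rwa [vertexLabel_shift hφ, hlab1]
        · refine hconnR _ ?_
          change vertexLabel φ (shift φ f (1, 1)).swap ∈ D
          rw [vertexLabel_swap hφ, vertexLabel_shift hφ, hlab1]
          simpa using h1)
      (by simpa using hcount)
  -- The fixed labels in `D` bound the number of orbits with nontrivial stabilizers.
  have hbound : {k ∈ (K : Set _) | ∃ v, cls v = k ∧ stabilizer G v ≠ ⊥}.ncard ≤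
      (D.filter fun u => (φ u)⁻¹ = u).card := by
    refine le_trans ?_ (Finset.card_image_le (f := orbitPair φ))
    rw [← Set.ncard_coe_finset]
    refine Set.ncard_le_ncard ?_ (Finset.finite_toSet _)
    rintro k ⟨hk, v, rfl, hv⟩
    have hv' := hfixlab v (hstab' v hv)
    obtain ⟨u, hu, huv⟩ := Finset.mem_image.1 (Finset.mem_coe.1 hk)
    refine Finset.mem_coe.2 (Finset.mem_image.2 ⟨_, Finset.mem_filter.2 ⟨?_, hv'⟩, rfl⟩)
    rcases (orbitPair_eq_iff hφ).1 huv with h | h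
    · rwa [← h]
    · rw [hv'] at h
      rwa [← h]
  have hXn : (X.erase (1, 1)).card ≤ n := by
    have h2 := Finset.card_erase_add_one hX₀
    have h3 : Fintype.card (E ⊕ M) = E.card + M.card := by simp
    have h4 : K.card = (D.image (orbitPair φ)).card := rfl
    omega
  have hne : Nonempty (X.erase (1, 1) ↪ Fin n) :=
    Function.Embedding.nonempty_of_card_le (by simpa using hXn)
  obtain ⟨ε⟩ := hne
  let s : V → FreeGroup (Fin n) := fun p => p.2 * p.1⁻¹
  set y := Function.extend ε (fun p => s p.1) 1 with hy
  have hyφ : ∀ i, φ (y i) = (y i)⁻¹ := by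
    intro i
    by_cases hi : ∃ p, ε p = i
    · obtain ⟨p, rfl⟩ := hi
      rw [hy, ε.injective.extend_apply]
      exact hstab' _ (hXstab _ (Finset.mem_of_mem_erase p.2))
    · rw [hy, Function.extend_apply' _ _ _ hi]
      simp
  refine ⟨y, hyφ, ?_⟩
  have hsy : ∀ p ∈ X, s p ∈ Subgroup.closure (Set.range y) := by
    intro p hp
    by_cases hp1 : p = (1, 1)
    · simp [hp1, s]
    · refine Subgroup.subset_closure ⟨ε ⟨p, Finset.mem_erase.2 ⟨hp1, hp⟩⟩, ?_⟩
      rw [hy, ε.injective.extend_apply]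
  have hHφ : ∀ f ∈ Subgroup.closure (Set.range y), φ f ∈ Subgroup.closure (Set.range y) := by
    intro f hf
    induction hf using Subgroup.closure_induction with
    | mem f hf =>
      obtain ⟨i, rfl⟩ := hf
      rw [hyφ]
      exact Subgroup.inv_mem _ (Subgroup.subset_closure ⟨i, rfl⟩)
    | one => rw [map_one]; exact Subgroup.one_mem _
    | mul f g _ _ h1 h2 => rw [map_mul]; exact Subgroup.mul_mem _ h1 h2
    | inv f _ h => rw [map_inv]; exact Subgroup.inv_mem _ h
  have hle : (⨆ x ∈ X, stabilizer G x) ≤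
      (swapGroup hφ (Subgroup.closure (Set.range y)) hHφ).subgroupOf G := by
    refine iSup₂_le fun p hp g hg => ?_
    rw [Subgroup.mem_subgroupOf]
    rcases eq_of_fixes hφ g.2 hg with h | ⟨h, -⟩
    · rw [h]; exact Subgroup.one_mem _
    · exact ⟨_, hsy p hp, Or.inr h⟩
  rw [hXtop] at hle
  refine eq_top_iff.2 fun f _ => ?_
  obtain ⟨f', hf', h | h⟩ := Subgroup.mem_subgroupOf.1
    (hle (Subgroup.mem_top (⟨shift φ f, hshift f⟩ : G)))
  · have := congrArg Prod.fst (DFunLike.congr_fun h (1, 1))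
    simp only [shift_apply, mul_one] at this
    rwa [this]
  · exact absurd h.symm (swapPerm_mul_shift_ne_shift i₀ _ _)

end Generation

theorem propositionc27 (n : ℕ) (φ : MulAut (FreeGroup (Fin n)))
    (hinv : φ * φ = 1) (hφ : autToGL n φ = -1) :
    IsConj φ (sigmaAut n) := by
  -- In rank zero the swap acts trivially on pairs, so this case is treated separately.
  rcases Nat.eq_zero_or_pos n with rfl | hn
  · rw [show φ = sigmaAut 0 from MulEquiv.ext fun x => Subsingleton.elim _ _]
  have hφφ : ∀ x, φ (φ x) = x := fun x => DFunLike.congr_fun hinv x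
  obtain ⟨y, hy, htop⟩ := exists_inverted_generators hφφ hφ ⟨0, hn⟩
  have hsurj : Function.Surjective (FreeGroup.lift y) := by
    rw [← MonoidHom.range_eq_top, FreeGroup.range_lift_eq_closure, htop]
  let θ : MulAut (FreeGroup (Fin n)) := MulEquiv.ofBijective (FreeGroup.lift y)
    ⟨FreeGroup.injective_of_surjective _ hsurj, hsurj⟩
  have hθ : φ.toMonoidHom.comp (FreeGroup.lift y) =
      (FreeGroup.lift y).comp (invertGenerators n) := by
    apply FreeGroup.ext_hom
    intro i
    simp [invertGenerators, hy]
  refine IsConj.symm (isConj_iff.2 ⟨θ, ?_⟩)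
  rw [mul_inv_eq_iff_eq_mul]
  ext x
  exact (DFunLike.congr_fun hθ x).symm
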